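/- Let $M$ be a complete (finite-dimensional, smooth, second countable) Riemannian manifold and let $G$ be a compact Lie group acting smoothly and isometrically on $M$. Let $\Sigma\subset M$ be a slice of the action through a point $x_0\in\Sigma$, i.e. an embedded submanifold such that 1. $T_{x_0}M=T_{x_0}(G\cdot x_0)\oplus T_{x_0}\Sigma$, and $T_xM=T_x(G\cdot x)+T_x\Sigma$ for every $x\in\Sigma$, where $T_x(G\cdot x)$ is the image of the Lie algebra of $G$ under the differential at the identity of $g\mapsto g\cdot x$; 2. $g\cdot x\in\Sigma$ for all $x\in\Sigma$ and all $g$ in the isotropy group $G_{x_0}$; 3. if $x\in\Sigma$, $g\in G$ and $g\cdot x\in\Sigma$, then $g\in G_{x_0}$; and let $G\cdot\Sigma=\{g\cdot x: g\in G,\ x\in\Sigma\}$ be the associated tube. For $y\in M$ let $\operatorname{vol}_y$ be the conditional of the volume along the orbit of $y$: the Riemannian volume measure of the embedded submanifold $G\cdot y$ (with the induced metric; counting measure if the orbit is finite), divided by its total mass, regarded as a Borel measure on $M$. Let $\psi$ be a real-valued $C^1$ function on $G\cdot\Sigma$ that is $G$-invariant, $\psi(g\cdot x)=\psi(x)$,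 and define $T:G\cdot\Sigma\to M$ by $T(x)=\exp_x(\nabla\psi(x))$, where $\nabla\psi$ is the Riemannian gradient and $\exp$ the Riemannian exponential map. Then: * $T(g\cdot x)=g\cdot T(x)$ for all $g\in G$ and $x\in G\cdot\Sigma$; * $T(G\cdot x)=G\cdot T(x)$ for all $x\in G\cdot\Sigma$; * for every $x\in G\cdot\Sigma$, $\operatorname{vol}_x$ and $\operatorname{vol}_{T(x)}$ are probability measures and $T$ is a transport map between them: $T$ is $\operatorname{vol}_x$-measurable and $T_*\operatorname{vol}_x=\operatorname{vol}_{T(x)}$. -/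

import Mathlib

open scoped Manifold Bundle ContDiff Topology ENNReal
open Bundle MeasureTheory

noncomputable section

namespace OrbitTransport

section Riemannian

variable {E : Type*} [NormedAddCommGroup E] [NormedSpace ℝ E]
  {M : Type*} [TopologicalSpace M] [ChartedSpace E M]
  [RiemannianBundle (fun x : M => TangentSpace 𝓘(ℝ, E) x)]

/-- The Riemannian metric read in a chart `e`: the bilinear form `v, w ↦ ∑ κ_ij(y) v_i w_j` on the
model space, at the point `y` of the target of `e`. -/
def chartMetric (e : OpenPartialHomeomorph M E) (y v w : E) : ℝ :=
  inner ℝ (mfderiv 𝓘(ℝ, E) 𝓘(ℝ, E) e.symm y v) (mfderiv 𝓘(ℝ, E) 𝓘(ℝ, E) e.symm y w)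

/-- A smooth curve `γ : ℝ → M` is a geodesic if it solves the geodesic equation in all smooth
charts. With `u = e ∘ γ` and `κ` the metric read in the chart, the equation is
`κ_u(u'', w) + (D κ_u)[u'](u', w) - (1/2) (D κ_u)[w](u', u') = 0` for all `w`,
that is `u''^k + Γ^k_ij u'^i u'^j = 0` with the index `k` lowered by the metric. -/
structure IsGeodesic (γ : ℝ → M) : Prop where
  contMDiff : ContMDiff 𝓘(ℝ, ℝ) 𝓘(ℝ, E) ∞ γ
  equation : ∀ e ∈ IsManifold.maximalAtlas 𝓘(ℝ, E) ∞ M, ∀ t : ℝ, γ t ∈ e.source → ∀ w : E,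
    chartMetric e (e (γ t)) (deriv (deriv (fun s => e (γ s))) t) w
      + fderiv ℝ (fun y => chartMetric e y (deriv (fun s => e (γ s)) t) w) (e (γ t))
          (deriv (fun s => e (γ s)) t)
      - (1 / 2 : ℝ) * fderiv ℝ (fun y => chartMetric e y (deriv (fun s => e (γ s)) t)
          (deriv (fun s => e (γ s)) t)) (e (γ t)) w = 0

/-- `γ` starts at the point `x` with velocity `v ∈ T_x M`. -/
def StartsWith (γ : ℝ → M) (x : M) (v : TangentSpace 𝓘(ℝ, E) x) : Prop :=
  (⟨γ 0, mfderiv 𝓘(ℝ, ℝ) 𝓘(ℝ, E) γ 0 (1 : ℝ)⟩ : TangentBundle 𝓘(ℝ, E) M) = ⟨x, v⟩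

open Classical in
/-- The Riemannian exponential map: `exp_x v = γ 1`, where `γ` is the geodesic with `γ 0 = x` and
`γ' 0 = v`. On a complete manifold this geodesic always exists, so that the `else` branch does
not occur there. -/
def riemannianExp (x : M) (v : TangentSpace 𝓘(ℝ, E) x) : M :=
  if h : ∃ γ : ℝ → M, IsGeodesic (E := E) γ ∧ StartsWith γ x v then h.choose 1 else x

/-- The gradient `∇ψ(x) ∈ T_x M`, the vector with `⟪∇ψ(x), v⟫ = dψ_x(v)` for all `v`. -/
def riemannianGradient [FiniteDimensional ℝ E] (ψ : M → ℝ) (x : M) : TangentSpace 𝓘(ℝ, E) x :=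
  haveI : FiniteDimensional ℝ (TangentSpace 𝓘(ℝ, E) x) := inferInstanceAs (FiniteDimensional ℝ E)
  haveI : CompleteSpace (TangentSpace 𝓘(ℝ, E) x) :=
    FiniteDimensional.complete ℝ (TangentSpace 𝓘(ℝ, E) x)
  (InnerProductSpace.toDual ℝ (TangentSpace 𝓘(ℝ, E) x)).symm (mfderiv 𝓘(ℝ, E) 𝓘(ℝ, ℝ) ψ x)

/-- `φ : U → S` is a local parametrization (the inverse of a chart) of the `m`-dimensional embedded
submanifold `S` of `M`. -/
structure IsLocalParametrization (m : ℕ) (S : Set M) (φ : EuclideanSpace ℝ (Fin m) → M)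
    (U : Set (EuclideanSpace ℝ (Fin m))) : Prop where
  isOpen : IsOpen U
  contMDiffOn : ContMDiffOn 𝓘(ℝ, EuclideanSpace ℝ (Fin m)) 𝓘(ℝ, E) ∞ φ U
  injective_mfderiv : ∀ u ∈ U,
    Function.Injective (mfderiv 𝓘(ℝ, EuclideanSpace ℝ (Fin m)) 𝓘(ℝ, E) φ u)
  isEmbedding : Topology.IsEmbedding (U.domRestrict φ)
  isOpen_image : ∃ V : Set M, IsOpen V ∧ φ '' U = V ∩ S

/-- The density `√det(κ(∂_i φ, ∂_j φ))` of the Riemannian volume in the parametrization `φ`. -/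
def volumeDensity {m : ℕ} (φ : EuclideanSpace ℝ (Fin m) → M) (u : EuclideanSpace ℝ (Fin m)) :
    ℝ≥0∞ :=
  ENNReal.ofReal <| Real.sqrt <| Matrix.det <| Matrix.of fun i j : Fin m =>
    (inner ℝ
      (mfderiv 𝓘(ℝ, EuclideanSpace ℝ (Fin m)) 𝓘(ℝ, E) φ u (EuclideanSpace.single i (1 : ℝ)))
      (mfderiv 𝓘(ℝ, EuclideanSpace ℝ (Fin m)) 𝓘(ℝ, E) φ u (EuclideanSpace.single j (1 : ℝ))) : ℝ)

/-- The Riemannian volume measure of an `m`-dimensional embedded submanifold `S` of `M` (with the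
induced metric), as a measure on `M` carried by `S`: in each local parametrization it is
`√det(κ_ij) dx_1 ⋯ dx_m`. These local measures agree on overlaps, and the volume measure is their
supremum. -/
def submanifoldVolume [MeasurableSpace M] (m : ℕ) (S : Set M) : Measure M :=
  ⨆ p : {p : (EuclideanSpace ℝ (Fin m) → M) × Set (EuclideanSpace ℝ (Fin m)) //
      IsLocalParametrization (E := E) m S p.1 p.2},
    ((volume.restrict p.1.2).withDensity (volumeDensity (E := E) p.1.1)).map p.1.1

end Riemannian

section Action

variable {E : Type*} [NormedAddCommGroup E] [NormedSpace ℝ E]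
  {M : Type*} [TopologicalSpace M] [ChartedSpace E M]
  {L : Type*} [NormedAddCommGroup L] [NormedSpace ℝ L]
  (G : Type*) [Group G] [TopologicalSpace G] [ChartedSpace L G] [MulAction G M]

/-- `G` acts by Riemannian isometries: the differentials of all translations `x ↦ g • x` preserve
the metric. -/
def IsIsometricAction [RiemannianBundle (fun x : M => TangentSpace 𝓘(ℝ, E) x)] : Prop :=
  ∀ (g : G) (x : M) (v w : TangentSpace 𝓘(ℝ, E) x),
    (inner ℝ (mfderiv 𝓘(ℝ, E) 𝓘(ℝ, E) (fun y : M => g • y) x v)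
      (mfderiv 𝓘(ℝ, E) 𝓘(ℝ, E) (fun y : M => g • y) x w) : ℝ) = inner ℝ v w

/-- The tangent space at `x` of the orbit `G • x`, that is the image of the Lie algebra `T_1 G`
under the differential of the orbit map `g ↦ g • x`. -/
def orbitTangent (x : M) : Submodule ℝ (TangentSpace 𝓘(ℝ, E) x) :=
  letI f : TangentSpace 𝓘(ℝ, L) (1 : G) →L[ℝ] TangentSpace 𝓘(ℝ, E) x :=
    mfderiv 𝓘(ℝ, L) 𝓘(ℝ, E) (fun g : G => g • x) 1
  LinearMap.range f.toLinearMap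

/-- The embedded submanifold `Σ = range ι` is a slice of the action of `G` at the point `ι s₀`. -/
structure IsSlice {F : Type*} [NormedAddCommGroup F] [NormedSpace ℝ F]
    {S : Type*} [TopologicalSpace S] [ChartedSpace F S] (ι : S → M) (s₀ : S) : Prop where
  isSmoothEmbedding : Manifold.IsSmoothEmbedding 𝓘(ℝ, F) 𝓘(ℝ, E) ∞ ι
  isCompl : IsCompl (orbitTangent (E := E) (L := L) G (ι s₀))
    (LinearMap.range (mfderiv 𝓘(ℝ, F) 𝓘(ℝ, E) ι s₀).toLinearMap)
  sup_eq_top : ∀ s : S, orbitTangent (E := E) (L := L) G (ι s) ⊔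
    LinearMap.range (mfderiv 𝓘(ℝ, F) 𝓘(ℝ, E) ι s).toLinearMap = ⊤
  smul_mem : ∀ g ∈ MulAction.stabilizer G (ι s₀), ∀ x ∈ Set.range ι, g • x ∈ Set.range ι
  mem_stabilizer : ∀ (g : G), ∀ x ∈ Set.range ι, g • x ∈ Set.range ι →
    g ∈ MulAction.stabilizer G (ι s₀)

/-- The tube `G • Σ`. -/
def tube (A : Set M) : Set M := {z | ∃ g : G, ∃ x ∈ A, z = g • x}

/-- The conditional `vol_x` of the volume along the orbit of `x`: the Riemannian volume measure of
the orbit `G • x`, normalized to total mass one, as a measure on `M` carried by the orbit. -/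
def orbitVol [RiemannianBundle (fun x : M => TangentSpace 𝓘(ℝ, E) x)] [MeasurableSpace M]
    (x : M) : Measure M :=
  let ν : Measure M := submanifoldVolume (E := E)
    (Module.finrank ℝ (orbitTangent (E := E) (L := L) G x)) (MulAction.orbit G x)
  (ν Set.univ)⁻¹ • ν

end Action

/-- `T` is a transport map between `μ` and `ν`. -/
def IsTransportMap {X : Type*} [MeasurableSpace X] (T : X → X) (μ ν : Measure X) : Prop :=
  AEMeasurable T μ ∧ μ.map T = ν

end OrbitTransport

end

/-!
The proof has two independent halves.

*Equivariance.* An isometry `g` maps geodesics to geodesics, and a geodesic is determined by its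
initial position and velocity, so `exp_{gx}(dg v) = g exp_x(v)` (`riemannianExp_smul`). Uniqueness
of geodesics is the uniqueness theorem for the geodesic equation in a chart, globalized by the
connectedness of the line (`IsGeodesic.unique`); their existence plays no role, since the value
assigned to `exp` without it is equivariant too. The tube is open, because the action map restricted
to `G × Σ` is a submersion along `{1} × Σ` (`IsSlice.isOpen_tube`); so the invariance of `ψ` can be
differentiated, and `∇ψ(gx) = dg(∇ψ(x))` (`riemannianGradient_smul`). Together these give
`T(gx) = g T(x)`, and hence `T(G • x) = G • T(x)`.

*Orbit volumes.* Whatever the point `x`, `vol_x` is the image of the Haar measure of `G` under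
`g ↦ g⁻¹ • x` (`orbitVol_eq_map_haar`). An equivariant map turns this image measure at `x` into the
one at `T x`, whatever the dimensions of the two orbits. To identify `vol_x`:

* The orbit map has constant rank, so by the constant rank theorem and the openness of the orbit map
  onto its image, the orbit is an embedded submanifold
  (`exists_isAdaptedParametrization_orbit`). Its volume is therefore positive.
* By the change of variables formula, the volumes defined by two parametrizations agree on the
  overlap (`localVolume_le_of_subset`); since finitely many translates of one small parametrization
  cover the orbit, its volume is finite and carried by it (`submanifoldVolume_orbit_lt_top`).
* Isometries permute the parametrizations and preserve their densities, so the volume is invariant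
  (`submanifoldVolume_orbit_map_smul`); and an invariant probability measure on an orbit of a compact
  group is unique (`eq_map_of_invariant_of_orbit`).
-/

noncomputable section

namespace OrbitTransport

/-! ### Pullbacks of the metric and differentials of translations -/

section PullbackMetric

variable {E : Type*} [NormedAddCommGroup E] [NormedSpace ℝ E]
  {M : Type*} [TopologicalSpace M] [ChartedSpace E M]
  [RiemannianBundle (fun x : M => TangentSpace 𝓘(ℝ, E) x)]
  {V : Type*} [NormedAddCommGroup V] [NormedSpace ℝ V]

/-- The pullback `φ^*κ` of the Riemannian metric under a map `φ` from a finite-dimensional space,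
at the point `y`, as a bilinear form. -/
def pullbackMetric [FiniteDimensional ℝ V] (φ : V → M) (y : V) : V →L[ℝ] V →L[ℝ] ℝ :=
  LinearMap.toContinuousBilinearMap <| LinearMap.mk₂ ℝ
    (fun v w => (inner ℝ (mfderiv 𝓘(ℝ, V) 𝓘(ℝ, E) φ y v) (mfderiv 𝓘(ℝ, V) 𝓘(ℝ, E) φ y w) : ℝ))
    (fun v v' w => by erw [map_add, inner_add_left])
    (fun c v w => by erw [map_smul, real_inner_smul_left]; rfl)
    (fun v w w' => by erw [map_add, inner_add_right])
    (fun c v w => by erw [map_smul, real_inner_smul_right]; rfl)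

theorem pullbackMetric_apply [FiniteDimensional ℝ V] (φ : V → M) (y v w : V) :
    pullbackMetric (E := E) φ y v w
      = inner ℝ (mfderiv 𝓘(ℝ, V) 𝓘(ℝ, E) φ y v) (mfderiv 𝓘(ℝ, V) 𝓘(ℝ, E) φ y w) := rfl

variable [IsManifold 𝓘(ℝ, E) ∞ M]
  [IsContMDiffRiemannianBundle 𝓘(ℝ, E) ∞ E (fun x : M => TangentSpace 𝓘(ℝ, E) x)]

/-- The coefficients of the metric pulled back by a smooth map are smooth: the vectors `dφ_y(v)`
form a smooth section along `φ`, and the metric is smooth. -/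
theorem contDiffOn_inner_mfderiv {φ : V → M} {U : Set V} (hU : IsOpen U)
    (hφ : ContMDiffOn 𝓘(ℝ, V) 𝓘(ℝ, E) ∞ φ U) (v w : V) :
    ContDiffOn ℝ ∞ (fun y => (inner ℝ (mfderiv 𝓘(ℝ, V) 𝓘(ℝ, E) φ y v)
      (mfderiv 𝓘(ℝ, V) 𝓘(ℝ, E) φ y w) : ℝ)) U := by
  have key : ∀ v : V, ContMDiffOn 𝓘(ℝ, V) (𝓘(ℝ, E).prod 𝓘(ℝ, E)) ∞
      (fun y => (⟨φ y, mfderiv 𝓘(ℝ, V) 𝓘(ℝ, E) φ y v⟩ :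
        TotalSpace E (fun x : M => TangentSpace 𝓘(ℝ, E) x))) U := by
    intro v
    have h1 := hφ.contMDiffOn_tangentMapWithin (m := ∞) (by simp) hU.uniqueMDiffOn
    have h2 : ContMDiffOn 𝓘(ℝ, V) (𝓘(ℝ, V).prod 𝓘(ℝ, V)) ∞
        (fun y => (⟨y, v⟩ : TangentBundle 𝓘(ℝ, V) V)) U := by
      intro y hy
      rw [contMDiffWithinAt_totalSpace]
      refine ⟨contMDiffWithinAt_id, ?_⟩
      simp only [trivializationAt_model_space_apply]
      exact contMDiffWithinAt_const
    refine (h1.comp h2 (fun y hy => hy)).congr fun y hy => ?_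
    simp only [Function.comp, tangentMapWithin]
    rw [mfderivWithin_of_isOpen hU hy]
  have := ContMDiffOn.inner_bundle (E := fun x : M => TangentSpace 𝓘(ℝ, E) x) (key v) (key w)
  exact contMDiffOn_iff_contDiffOn.1 this

theorem contDiffOn_pullbackMetric [FiniteDimensional ℝ V] {φ : V → M} {U : Set V} (hU : IsOpen U)
    (hφ : ContMDiffOn 𝓘(ℝ, V) 𝓘(ℝ, E) ∞ φ U) :
    ContDiffOn ℝ ∞ (pullbackMetric (E := E) φ) U := by
  rw [contDiffOn_clm_apply]
  intro v
  rw [contDiffOn_clm_apply]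
  exact fun w => contDiffOn_inner_mfderiv hU hφ v w

end PullbackMetric

section Translations

variable {E : Type*} [NormedAddCommGroup E] [NormedSpace ℝ E]
  {M : Type*} [TopologicalSpace M] [ChartedSpace E M]
  {G : Type*} [Group G] [MulAction G M]

/-- The chain rule for translations. Smoothness of the action enters only through the hypothesis
`hs` on the single translations, which needs no topology on the group. -/
theorem mfderiv_translation_mul
    (hs : ∀ g : G, ContMDiff 𝓘(ℝ, E) 𝓘(ℝ, E) ∞ (fun y : M => g • y)) (g h : G) (x : M) :
    mfderiv 𝓘(ℝ, E) 𝓘(ℝ, E) (fun y : M => (g * h) • y) x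
      = (mfderiv 𝓘(ℝ, E) 𝓘(ℝ, E) (fun y : M => g • y) (h • x)).comp
        (mfderiv 𝓘(ℝ, E) 𝓘(ℝ, E) (fun y : M => h • y) x) := by
  rw [← mfderiv_comp x ((hs g).mdifferentiable (by simp) (h • x))
    ((hs h).mdifferentiable (by simp) x)]
  congr 1
  ext y
  exact mul_smul g h y

theorem mfderiv_translation_injective
    (hs : ∀ g : G, ContMDiff 𝓘(ℝ, E) 𝓘(ℝ, E) ∞ (fun y : M => g • y)) (g : G) (x : M) :
    Function.Injective (mfderiv 𝓘(ℝ, E) 𝓘(ℝ, E) (fun y : M => g • y) x) := by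
  have h := mfderiv_translation_mul hs g⁻¹ g x
  have h1 : (fun y : M => (g⁻¹ * g) • y) = id := by ext y; simp
  rw [h1, mfderiv_id] at h
  intro v w hvw
  have hv := DFunLike.congr_fun h v
  have hw := DFunLike.congr_fun h w
  exact hv.trans ((congrArg (mfderiv 𝓘(ℝ, E) 𝓘(ℝ, E) (fun y : M => g⁻¹ • y) (g • x)) hvw).trans
    hw.symm)

theorem mfderiv_translation_surjective
    (hs : ∀ g : G, ContMDiff 𝓘(ℝ, E) 𝓘(ℝ, E) ∞ (fun y : M => g • y)) (g : G) (x : M) :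
    Function.Surjective (mfderiv 𝓘(ℝ, E) 𝓘(ℝ, E) (fun y : M => g • y) x) := by
  intro w
  have h := mfderiv_translation_mul hs g g⁻¹ (g • x)
  have h1 : (fun y : M => (g * g⁻¹) • y) = id := by ext y; simp
  rw [h1, mfderiv_id, inv_smul_smul] at h
  exact ⟨_, (DFunLike.congr_fun h w).symm⟩

end Translations

/-! ### The geodesic equation in a vector space -/

section GeodesicEquation

-- Needed to find the normed structure on the space of trilinear forms.
set_option maxSynthPendingDepth 3

variable {E : Type*} [NormedAddCommGroup E] [NormedSpace ℝ E]

/-- A nondegenerate form on a finite-dimensional space is an isomorphism onto the dual. -/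
theorem exists_equiv_dual_of_anisotropic [FiniteDimensional ℝ E] (B : E →L[ℝ] E →L[ℝ] ℝ)
    (hB : ∀ v, B v v = 0 → v = 0) :
    ∃ A : E ≃L[ℝ] (E →L[ℝ] ℝ), (A : E →L[ℝ] E →L[ℝ] ℝ) = B := by
  have hinj : Function.Injective B.toLinearMap := by
    rw [← LinearMap.ker_eq_bot, LinearMap.ker_eq_bot']
    intro v hv
    exact hB v (by simpa using DFunLike.congr_fun (show B v = 0 from hv) v)
  have hdim : Module.finrank ℝ E = Module.finrank ℝ (E →L[ℝ] ℝ) := by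
    rw [← (LinearMap.toContinuousLinearMap (𝕜 := ℝ) (E := E) (F' := ℝ)).finrank_eq]
    exact (Subspace.dual_finrank_eq (K := ℝ) (V := E)).symm
  refine ⟨(LinearEquiv.ofInjectiveOfFinrankEq B.toLinearMap hinj hdim).toContinuousLinearEquiv, ?_⟩
  ext v w
  rfl

/-- The right-hand side of the geodesic equation of the metric `κ`, written as
`κ_u(u'', ·) = F(u, u')` with values in the dual space. -/
def geodesicForce (κ : E → E →L[ℝ] E →L[ℝ] ℝ) (z : E × E) : E →L[ℝ] ℝ :=
  (1 / 2 : ℝ) • ((fderiv ℝ κ z.1).flip z.2).flip z.2 - fderiv ℝ κ z.1 z.2 z.2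

theorem geodesicForce_apply (κ : E → E →L[ℝ] E →L[ℝ] ℝ) (z : E × E) (w : E) :
    geodesicForce κ z w
      = (1 / 2 : ℝ) * fderiv ℝ κ z.1 w z.2 z.2 - fderiv ℝ κ z.1 z.2 z.2 w := by
  simp [geodesicForce]

/-- The first-order vector field on position-velocity pairs whose integral curves are the solutions
of the geodesic equation is `C^1`, hence locally Lipschitz. -/
theorem contDiffAt_geodesicField [FiniteDimensional ℝ E] {κ : E → E →L[ℝ] E →L[ℝ] ℝ}
    {Ω : Set E} (hΩ : IsOpen Ω)
    (hκ : ContDiffOn ℝ ∞ κ Ω) (hpos : ∀ y ∈ Ω, ∀ v, κ y v v = 0 → v = 0) {z : E × E}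
    (hz : z.1 ∈ Ω) :
    ContDiffAt ℝ 1 (fun z : E × E => (z.2, (κ z.1).inverse (geodesicForce κ z))) z := by
  have hΩ' : IsOpen (Prod.fst ⁻¹' Ω : Set (E × E)) := hΩ.preimage continuous_fst
  have hκ1 : ContDiffOn ℝ 1 (fun z : E × E => κ z.1) (Prod.fst ⁻¹' Ω) :=
    (hκ.of_le (by exact_mod_cast le_top)).comp contDiff_fst.contDiffOn fun z hz => hz
  have hD : ContDiffOn ℝ 1 (fun z : E × E => fderiv ℝ κ z.1) (Prod.fst ⁻¹' Ω) :=
    (hκ.fderiv_of_isOpen hΩ (m := 1) (by norm_cast)).comp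
      contDiff_fst.contDiffOn fun z hz => hz
  have h2 : ContDiffOn ℝ 1 (fun z : E × E => z.2) (Prod.fst ⁻¹' Ω) := contDiff_snd.contDiffOn
  have hF : ContDiffOn ℝ 1 (geodesicForce κ) (Prod.fst ⁻¹' Ω) := by
    rw [contDiffOn_clm_apply]
    intro w
    simp only [geodesicForce_apply]
    exact (contDiffOn_const.mul (((hD.clm_apply contDiffOn_const).clm_apply h2).clm_apply h2)).sub
      (((hD.clm_apply h2).clm_apply h2).clm_apply contDiffOn_const)
  have hnz : (Prod.fst ⁻¹' Ω : Set (E × E)) ∈ 𝓝 z := hΩ'.mem_nhds hz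
  obtain ⟨A, hA⟩ := exists_equiv_dual_of_anisotropic (κ z.1) (hpos _ hz)
  have hinv : ContDiffAt ℝ 1 (fun z : E × E => (κ z.1).inverse) z := by
    have h := contDiffAt_map_inverse (n := 1) A
    rw [hA] at h
    exact h.comp z (hκ1.contDiffAt hnz)
  exact contDiffAt_snd.prodMk (hinv.clm_apply (hF.contDiffAt hnz))

/-- Solutions of the geodesic equation of a smooth metric on an open subset of a vector space are
determined near `t` by their position and velocity at time `t`. -/
theorem eventuallyEq_of_geodesic_equation [FiniteDimensional ℝ E] {κ : E → E →L[ℝ] E →L[ℝ] ℝ}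
    {Ω : Set E} (hΩ : IsOpen Ω)
    (hκ : ContDiffOn ℝ ∞ κ Ω) (hpos : ∀ y ∈ Ω, ∀ v, κ y v v = 0 → v = 0) {u : Fin 2 → ℝ → E}
    {t : ℝ} (hu : ∀ i, ContDiffAt ℝ 2 (u i) t)
    (heq : ∀ i, ∀ᶠ s in 𝓝 t, ∀ w, κ (u i s) (deriv (deriv (u i)) s) w
      + fderiv ℝ κ (u i s) (deriv (u i) s) (deriv (u i) s) w
      - (1 / 2 : ℝ) * fderiv ℝ κ (u i s) w (deriv (u i) s) (deriv (u i) s) = 0)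
    (hmem : u 0 t ∈ Ω) (h0 : u 0 t = u 1 t) (h1 : deriv (u 0) t = deriv (u 1) t) :
    u 0 =ᶠ[𝓝 t] u 1 := by
  have hz : ∀ i, u i t = u 0 t ∧ deriv (u i) t = deriv (u 0) t := by
    intro i
    fin_cases i
    · exact ⟨rfl, rfl⟩
    · exact ⟨h0.symm, h1.symm⟩
  obtain ⟨K, s, hs, hK⟩ := (contDiffAt_geodesicField (z := (u 0 t, deriv (u 0) t)) hΩ hκ hpos
    hmem).exists_lipschitzOnWith
  have hsol : ∀ i, ∀ᶠ r in 𝓝 t, HasDerivAt (fun r => (u i r, deriv (u i) r))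
      ((fun z : E × E => (z.2, (κ z.1).inverse (geodesicForce κ z))) (u i r, deriv (u i) r)) r ∧
        (u i r, deriv (u i) r) ∈ s := by
    intro i
    have hd : ContDiffAt ℝ 1 (deriv (u i)) t := by
      have h2 : ContDiffAt ℝ 1 (fderiv ℝ (u i)) t := (hu i).fderiv_right (by norm_num)
      exact h2.clm_apply contDiffAt_const
    have hc : ContinuousAt (fun r => (u i r, deriv (u i) r)) t :=
      (hu i).continuousAt.prodMk hd.continuousAt
    have hs' : s ∈ 𝓝 (u i t, deriv (u i) t) := by rw [(hz i).1, (hz i).2]; exact hs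
    have hΩ' : ∀ᶠ r in 𝓝 t, u i r ∈ Ω :=
      (hu i).continuousAt.eventually_mem (hΩ.mem_nhds (by rw [(hz i).1]; exact hmem))
    filter_upwards [hc.eventually_mem hs', hΩ', heq i,
      ((hu i).of_le one_le_two).eventually (by simp), hd.eventually (by simp)]
      with r hr1 hr2 hr3 hr4 hr5
    refine ⟨?_, hr1⟩
    obtain ⟨A, hA⟩ := exists_equiv_dual_of_anisotropic (κ (u i r)) (hpos _ hr2)
    have hacc : deriv (deriv (u i)) r
        = (κ (u i r)).inverse (geodesicForce κ (u i r, deriv (u i) r)) := by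
      have : κ (u i r) (deriv (deriv (u i)) r) = geodesicForce κ (u i r, deriv (u i) r) := by
        ext w
        rw [geodesicForce_apply]
        linarith [hr3 w]
      rw [← this, ← hA, ContinuousLinearMap.inverse_equiv]
      simp
    have hp := (hr4.differentiableAt (by simp)).hasDerivAt.prodMk
      (hr5.differentiableAt (by simp)).hasDerivAt
    rw [hacc] at hp
    exact hp
  have := ODE_solution_unique_of_eventually (v := fun _ z => (z.2, (κ z.1).inverse
    (geodesicForce κ z))) (s := fun _ => s) (Filter.Eventually.of_forall fun _ => hK)
    (hsol 0) (hsol 1) (by simp [h0, h1])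
  filter_upwards [this] with r hr
  exact congrArg Prod.fst hr

end GeodesicEquation

/-! ### Uniqueness and equivariance of geodesics -/

section Curves

variable {E : Type*} [NormedAddCommGroup E] [NormedSpace ℝ E]
  {M : Type*} [TopologicalSpace M] [ChartedSpace E M]

theorem contDiffAt_chart_comp {γ : ℝ → M} (hγ : ContMDiff 𝓘(ℝ, ℝ) 𝓘(ℝ, E) ∞ γ)
    {e : OpenPartialHomeomorph M E} (he : e ∈ IsManifold.maximalAtlas 𝓘(ℝ, E) ∞ M) {t : ℝ}
    (ht : γ t ∈ e.source) : ContDiffAt ℝ ∞ (fun s => e (γ s)) t :=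
  ((contMDiffAt_of_mem_maximalAtlas he ht).comp t hγ.contMDiffAt).contDiffAt

theorem deriv_chart_comp {γ : ℝ → M} (hγ : ContMDiff 𝓘(ℝ, ℝ) 𝓘(ℝ, E) ∞ γ)
    {e : OpenPartialHomeomorph M E} (he : e ∈ IsManifold.maximalAtlas 𝓘(ℝ, E) ∞ M) {t : ℝ}
    (ht : γ t ∈ e.source) :
    deriv (fun s => e (γ s)) t
      = mfderiv 𝓘(ℝ, E) 𝓘(ℝ, E) e (γ t) (mfderiv 𝓘(ℝ, ℝ) 𝓘(ℝ, E) γ t (1 : ℝ)) := by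
  have h := mfderiv_comp t ((contMDiffAt_of_mem_maximalAtlas he ht).mdifferentiableAt (by simp))
    (hγ.mdifferentiable (by simp) t)
  rw [mfderiv_eq_fderiv] at h
  exact DFunLike.congr_fun h (1 : ℝ)

theorem StartsWith.smul {G : Type*} [Group G] [MulAction G M]
    (hs : ∀ g : G, ContMDiff 𝓘(ℝ, E) 𝓘(ℝ, E) ∞ (fun y : M => g • y))
    (g : G) {γ : ℝ → M} (hγ : ContMDiff 𝓘(ℝ, ℝ) 𝓘(ℝ, E) ∞ γ) {x : M}
    {v : TangentSpace 𝓘(ℝ, E) x} (h : StartsWith γ x v) :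
    StartsWith (fun t => g • γ t) (g • x)
      (mfderiv 𝓘(ℝ, E) 𝓘(ℝ, E) (fun y : M => g • y) x v) := by
  have h1 := mfderiv_comp (0 : ℝ) ((hs g).mdifferentiable (by simp) (γ 0))
    (hγ.mdifferentiable (by simp) 0)
  have h2 : tangentMap 𝓘(ℝ, ℝ) 𝓘(ℝ, E) (fun t => g • γ t) ⟨0, (1 : ℝ)⟩
      = tangentMap 𝓘(ℝ, E) 𝓘(ℝ, E) (fun y : M => g • y) ⟨x, v⟩ := by
    rw [← h]
    exact congrArg (TotalSpace.mk (F := E) (E := fun x : M => TangentSpace 𝓘(ℝ, E) x) (g • γ 0))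
      (DFunLike.congr_fun h1 (1 : ℝ))
  exact h2

end Curves

section GeodesicUniqueness

variable {E : Type*} [NormedAddCommGroup E] [NormedSpace ℝ E]
  {M : Type*} [TopologicalSpace M] [ChartedSpace E M]
  [RiemannianBundle (fun x : M => TangentSpace 𝓘(ℝ, E) x)]

/-- The metric read in a chart is definite, since the differential of a chart is injective. -/
theorem eq_zero_of_chartMetric_self {e : OpenPartialHomeomorph M E}
    (he : e ∈ IsManifold.maximalAtlas 𝓘(ℝ, E) ∞ M) {y : E} (hy : y ∈ e.target) {v : E}
    (hv : chartMetric e y v v = 0) : v = 0 := by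
  have h1 : mfderiv 𝓘(ℝ, E) 𝓘(ℝ, E) e.symm y v = 0 := inner_self_eq_zero.1 hv
  have hs : MDifferentiableAt 𝓘(ℝ, E) 𝓘(ℝ, E) e.symm y :=
    (contMDiffAt_symm_of_mem_maximalAtlas he hy).mdifferentiableAt (by simp)
  have he' : MDifferentiableAt 𝓘(ℝ, E) 𝓘(ℝ, E) e (e.symm y) :=
    (contMDiffAt_of_mem_maximalAtlas he (e.map_target hy)).mdifferentiableAt (by simp)
  have h2 := mfderiv_comp y he' hs
  have h3 : e ∘ e.symm =ᶠ[𝓝 y] id := by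
    filter_upwards [e.open_target.mem_nhds hy] with z hz using e.right_inv hz
  rw [h3.mfderiv_eq, mfderiv_id] at h2
  have h4 := DFunLike.congr_fun h2 v
  exact h4.trans ((congrArg (mfderiv 𝓘(ℝ, E) 𝓘(ℝ, E) e (e.symm y)) h1).trans (map_zero _))

variable [IsManifold 𝓘(ℝ, E) ∞ M] [FiniteDimensional ℝ E]
  [IsContMDiffRiemannianBundle 𝓘(ℝ, E) ∞ E (fun x : M => TangentSpace 𝓘(ℝ, E) x)]

/-- Local uniqueness of geodesics. The pair of geodesics is indexed by `Fin 2`, so that facts about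
both are stated once. -/
theorem IsGeodesic.eventuallyEq {γ : Fin 2 → ℝ → M} (hγ : ∀ i, IsGeodesic (E := E) (γ i))
    {e : OpenPartialHomeomorph M E} (he : e ∈ IsManifold.maximalAtlas 𝓘(ℝ, E) ∞ M) {t : ℝ}
    (ht : γ 0 t ∈ e.source) (h0 : γ 0 t = γ 1 t)
    (h1 : deriv (fun s => e (γ 0 s)) t = deriv (fun s => e (γ 1 s)) t) :
    γ 0 =ᶠ[𝓝 t] γ 1 := by
  have hmem : ∀ i, γ i t ∈ e.source := by
    intro i
    fin_cases i
    · exact ht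
    · exact (h0 ▸ ht :)
  have hsrc : ∀ i, ∀ᶠ s in 𝓝 t, γ i s ∈ e.source := fun i =>
    (hγ i).contMDiff.continuous.continuousAt.eventually_mem (e.open_source.mem_nhds (hmem i))
  have hκ := contDiffOn_pullbackMetric (E := E) e.open_target
    (contMDiffOn_symm_of_mem_maximalAtlas he)
  have key := eventuallyEq_of_geodesic_equation (κ := pullbackMetric (E := E) e.symm)
    (u := fun i s => e (γ i s)) (t := t) e.open_target hκ
    (fun y hy v hv => eq_zero_of_chartMetric_self he hy hv)
    (fun i => (contDiffAt_chart_comp (hγ i).contMDiff he (hmem i)).of_le (by norm_cast))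
    (fun i => by
      filter_upwards [hsrc i] with s hs w
      have hd : DifferentiableAt ℝ (pullbackMetric (E := E) e.symm) (e (γ i s)) :=
        (hκ.contDiffAt
          (e.open_target.mem_nhds (e.map_source hs))).differentiableAt (by simp)
      have hf : ∀ p q : E, ∀ a : E, fderiv ℝ (fun y => chartMetric e y p q) (e (γ i s)) a
          = fderiv ℝ (pullbackMetric (E := E) e.symm) (e (γ i s)) a p q := by
        intro p q a
        have h := ((hd.hasFDerivAt.clm_apply (hasFDerivAt_const p _)).clm_apply
          (hasFDerivAt_const q _)).fderiv
        have h' := DFunLike.congr_fun h a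
        simpa [pullbackMetric_apply, chartMetric] using h'
      have h := (hγ i).equation e he s hs w
      rw [hf, hf] at h
      exact h)
    (e.map_source ht) (congrArg e h0) h1
  filter_upwards [key, hsrc 0, hsrc 1] with s hs hs0 hs1
  exact e.injOn hs0 hs1 hs

/-- Geodesics are determined by their initial position and velocity. -/
theorem IsGeodesic.unique [T2Space M] {γ₁ γ₂ : ℝ → M} (h₁ : IsGeodesic (E := E) γ₁)
    (h₂ : IsGeodesic (E := E) γ₂) {x : M} {v : TangentSpace 𝓘(ℝ, E) x}
    (s₁ : StartsWith γ₁ x v) (s₂ : StartsWith γ₂ x v) : γ₁ = γ₂ := by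
  let γ : Fin 2 → ℝ → M := ![γ₁, γ₂]
  have hγ : ∀ i, IsGeodesic (E := E) (γ i) := by
    intro i
    fin_cases i
    · exact h₁
    · exact h₂
  -- The set of times near which the two geodesics agree is open and closed.
  let A : Set ℝ := {t | γ₁ =ᶠ[𝓝 t] γ₂}
  have hopen : IsOpen A := isOpen_iff_mem_nhds.2 fun t ht => ht.eventually_nhds
  have hclosed : IsClosed A := by
    refine isClosed_of_closure_subset fun t ht => ?_
    have hpos : γ₁ t = γ₂ t := by
      have hc : IsClosed {s | γ₁ s = γ₂ s} :=
        isClosed_eq h₁.contMDiff.continuous h₂.contMDiff.continuous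
      exact hc.closure_subset_iff.2 (fun s (hs : γ₁ =ᶠ[𝓝 s] γ₂) => hs.eq_of_nhds) ht
    let e := chartAt E (γ₁ t)
    have he : e ∈ IsManifold.maximalAtlas 𝓘(ℝ, E) ∞ M := IsManifold.chart_mem_maximalAtlas _
    have hsrc : γ₁ t ∈ e.source := mem_chart_source E _
    refine IsGeodesic.eventuallyEq hγ he hsrc hpos ?_
    have hcd : ∀ {γ : ℝ → M}, IsGeodesic (E := E) γ → γ t ∈ e.source →
        ContinuousAt (deriv (fun s => e (γ s))) t := by
      intro γ hγ hs
      have h2 : ContDiffAt ℝ 0 (fderiv ℝ (fun s => e (γ s))) t :=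
        (contDiffAt_chart_comp hγ.contMDiff he hs).fderiv_right (by norm_num)
      exact (h2.clm_apply contDiffAt_const).continuousAt
    have c1 := hcd h₁ hsrc
    have c2 := hcd h₂ (hpos ▸ hsrc)
    -- The velocities agree on `A`, hence at the limit point `t`.
    have : (𝓝[A] t).NeBot := mem_closure_iff_nhdsWithin_neBot.1 ht
    refine tendsto_nhds_unique (c1.tendsto.mono_left (nhdsWithin_le_nhds (s := A)))
      ((c2.tendsto.mono_left (nhdsWithin_le_nhds (s := A))).congr' ?_)
    filter_upwards [self_mem_nhdsWithin] with s hs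
    have hs' : γ₁ =ᶠ[𝓝 s] γ₂ := hs
    exact (hs'.fun_comp e).deriv_eq.symm
  have h0 : (0 : ℝ) ∈ A := by
    have hT : (⟨γ₁ 0, mfderiv 𝓘(ℝ, ℝ) 𝓘(ℝ, E) γ₁ 0 (1 : ℝ)⟩ : TangentBundle 𝓘(ℝ, E) M)
      = ⟨γ₂ 0, mfderiv 𝓘(ℝ, ℝ) 𝓘(ℝ, E) γ₂ 0 (1 : ℝ)⟩ := s₁.trans s₂.symm
    have hpos : γ₁ 0 = γ₂ 0 := congrArg (fun p => p.1) hT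
    let e := chartAt E (γ₁ 0)
    have he : e ∈ IsManifold.maximalAtlas 𝓘(ℝ, E) ∞ M := IsManifold.chart_mem_maximalAtlas _
    have hsrc : γ₁ 0 ∈ e.source := mem_chart_source E _
    refine IsGeodesic.eventuallyEq hγ he hsrc hpos ?_
    change deriv (fun s => e (γ₁ s)) 0 = deriv (fun s => e (γ₂ s)) 0
    rw [deriv_chart_comp h₁.contMDiff he hsrc, deriv_chart_comp h₂.contMDiff he (hpos ▸ hsrc)]
    exact congrArg (fun p : TangentBundle 𝓘(ℝ, E) M =>
      (mfderiv 𝓘(ℝ, E) 𝓘(ℝ, E) e p.1 p.2 : E)) hT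
  have huniv : A = Set.univ := IsClopen.eq_univ ⟨hclosed, hopen⟩ ⟨0, h0⟩
  ext t
  have : t ∈ A := huniv ▸ Set.mem_univ t
  exact Filter.EventuallyEq.eq_of_nhds this

end GeodesicUniqueness

section GeodesicTranslation

variable {E : Type*} [NormedAddCommGroup E] [NormedSpace ℝ E]
  {M : Type*} [TopologicalSpace M] [ChartedSpace E M]
  [RiemannianBundle (fun x : M => TangentSpace 𝓘(ℝ, E) x)]
  {G : Type*} [Group G] [MulAction G M]

/-- Composing a map with a translation does not change the pulled back metric. -/
theorem inner_mfderiv_smul {V : Type*} [NormedAddCommGroup V] [NormedSpace ℝ V]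
    (hs : ∀ g : G, ContMDiff 𝓘(ℝ, E) 𝓘(ℝ, E) ∞ (fun y : M => g • y))
    (hiso : IsIsometricAction (E := E) (M := M) G)
    (g : G) {φ : V → M} {y : V} (hφ : MDifferentiableAt 𝓘(ℝ, V) 𝓘(ℝ, E) φ y) (v w : V) :
    (inner ℝ (mfderiv 𝓘(ℝ, V) 𝓘(ℝ, E) (fun z => g • φ z) y v)
      (mfderiv 𝓘(ℝ, V) 𝓘(ℝ, E) (fun z => g • φ z) y w) : ℝ)
    = inner ℝ (mfderiv 𝓘(ℝ, V) 𝓘(ℝ, E) φ y v) (mfderiv 𝓘(ℝ, V) 𝓘(ℝ, E) φ y w) := by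
  have h : mfderiv 𝓘(ℝ, V) 𝓘(ℝ, E) (fun z => g • φ z) y
      = (mfderiv 𝓘(ℝ, E) 𝓘(ℝ, E) (fun y : M => g • y) (φ y)).comp
        (mfderiv 𝓘(ℝ, V) 𝓘(ℝ, E) φ y) :=
    mfderiv_comp y ((hs g).mdifferentiable (by simp) (φ y)) hφ
  rw [h]
  exact hiso g (φ y) _ _

variable [IsManifold 𝓘(ℝ, E) ∞ M]

/-- Isometric translations map geodesics to geodesics: the equation of `g • γ` in a chart `e` is
that of `γ` in the chart `e ∘ g`. -/
theorem IsGeodesic.smul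
    (hs : ∀ g : G, ContMDiff 𝓘(ℝ, E) 𝓘(ℝ, E) ∞ (fun y : M => g • y))
    (hiso : IsIsometricAction (E := E) (M := M) G)
    (g : G) {γ : ℝ → M} (hγ : IsGeodesic (E := E) γ) :
    IsGeodesic (E := E) (fun t => g • γ t) where
  contMDiff := (hs g).comp hγ.contMDiff
  equation := by
    intro e he t ht w
    have : ContinuousConstSMul G M := ⟨fun g => (hs g).continuous⟩
    let e' : OpenPartialHomeomorph M E := (Homeomorph.smul g).transOpenPartialHomeomorph e
    have hsymm : (e.symm : E → M) = fun y => g • e'.symm y := by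
      ext y
      exact (smul_inv_smul g (e.symm y)).symm
    have he' : e' ∈ IsManifold.maximalAtlas 𝓘(ℝ, E) ∞ M := by
      refine OpenPartialHomeomorph.mem_maximalAtlas_of_contMDiffOn _ ?_ ?_
      · exact (contMDiffOn_of_mem_maximalAtlas he).comp (hs g).contMDiffOn fun y hy => hy
      · exact (hs g⁻¹).comp_contMDiffOn (contMDiffOn_symm_of_mem_maximalAtlas he)
    have hm : ∀ y ∈ e.target, ∀ v w, chartMetric e y v w = chartMetric e' y v w := by
      intro y hy v w
      have hd : MDifferentiableAt 𝓘(ℝ, E) 𝓘(ℝ, E) e'.symm y :=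
        (contMDiffAt_symm_of_mem_maximalAtlas he' hy).mdifferentiableAt (by simp)
      have h : ∀ f : E → M, f = (fun y => g • e'.symm y) →
          (inner ℝ (mfderiv 𝓘(ℝ, E) 𝓘(ℝ, E) f y v) (mfderiv 𝓘(ℝ, E) 𝓘(ℝ, E) f y w) : ℝ)
            = chartMetric e' y v w := by
        rintro _ rfl
        exact inner_mfderiv_smul hs hiso g hd v w
      exact h _ hsymm
    have hn : e.target ∈ 𝓝 (e (g • γ t)) := e.open_target.mem_nhds (e.map_source ht)
    have hm' : ∀ v w, (fun y => chartMetric e y v w) =ᶠ[𝓝 (e (g • γ t))]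
        fun y => chartMetric e' y v w := fun v w => by
      filter_upwards [hn] with y hy using hm y hy v w
    rw [hm _ (e.map_source ht), (hm' _ _).fderiv_eq, (hm' _ _).fderiv_eq]
    exact hγ.equation e' he' t ht w

variable [FiniteDimensional ℝ E] [T2Space M]
  [IsContMDiffRiemannianBundle 𝓘(ℝ, E) ∞ E (fun x : M => TangentSpace 𝓘(ℝ, E) x)]

/-- By uniqueness, any geodesic with the given initial data computes the exponential map, not only
the one chosen in its definition. -/
theorem riemannianExp_eq {γ : ℝ → M} (hγ : IsGeodesic (E := E) γ) {x : M}
    {v : TangentSpace 𝓘(ℝ, E) x} (h : StartsWith γ x v) : riemannianExp x v = γ 1 := by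
  have hex : ∃ γ : ℝ → M, IsGeodesic (E := E) γ ∧ StartsWith γ x v := ⟨γ, hγ, h⟩
  rw [riemannianExp, dif_pos hex,
    IsGeodesic.unique hex.choose_spec.1 hγ hex.choose_spec.2 h]

/-- The Riemannian exponential map commutes with isometries: `exp_{gx}(dg v) = g exp_x(v)`. -/
theorem riemannianExp_smul
    (hs : ∀ g : G, ContMDiff 𝓘(ℝ, E) 𝓘(ℝ, E) ∞ (fun y : M => g • y))
    (hiso : IsIsometricAction (E := E) (M := M) G)
    (g : G) (x : M) (v : TangentSpace 𝓘(ℝ, E) x) :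
    riemannianExp (g • x) (mfderiv 𝓘(ℝ, E) 𝓘(ℝ, E) (fun y : M => g • y) x v)
      = g • riemannianExp x v := by
  by_cases hex : ∃ γ : ℝ → M, IsGeodesic (E := E) γ ∧ StartsWith γ x v
  · obtain ⟨γ, hγ, h⟩ := hex
    rw [riemannianExp_eq hγ h, riemannianExp_eq (hγ.smul hs hiso g) (h.smul hs g hγ.contMDiff)]
  · -- A geodesic with the translated initial data would translate back to one for `(x, v)`.
    have hex' : ¬ ∃ γ : ℝ → M, IsGeodesic (E := E) γ ∧ StartsWith γ (g • x)
        (mfderiv 𝓘(ℝ, E) 𝓘(ℝ, E) (fun y : M => g • y) x v) := by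
      rintro ⟨γ, hγ, h⟩
      refine hex ⟨_, hγ.smul hs hiso g⁻¹, ?_⟩
      have h' := h.smul hs g⁻¹ hγ.contMDiff
      have h2 := mfderiv_translation_mul hs g⁻¹ g x
      have h3 : tangentMap 𝓘(ℝ, E) 𝓘(ℝ, E) (fun y : M => (g⁻¹ * g) • y) ⟨x, v⟩ = ⟨x, v⟩ := by
        have : (fun y : M => (g⁻¹ * g) • y) = id := by ext y; simp
        rw [this, tangentMap_id, id]
      refine Eq.trans h' (Eq.trans ?_ h3)
      rw [tangentMap, h2]
      exact TotalSpace.ext (mul_smul g⁻¹ g x).symm HEq.rfl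
    rw [riemannianExp, riemannianExp, dif_neg hex, dif_neg hex']

end GeodesicTranslation

/-! ### Equivariance of the gradient and openness of the tube -/

section Gradient

variable {E : Type*} [NormedAddCommGroup E] [NormedSpace ℝ E] [FiniteDimensional ℝ E]
  {M : Type*} [TopologicalSpace M] [ChartedSpace E M]
  [RiemannianBundle (fun x : M => TangentSpace 𝓘(ℝ, E) x)]
  {G : Type*} [Group G] [MulAction G M]

theorem inner_riemannianGradient (ψ : M → ℝ) (x : M) (v : TangentSpace 𝓘(ℝ, E) x) :
    (inner ℝ (riemannianGradient (E := E) ψ x) v : ℝ) = mfderiv 𝓘(ℝ, E) 𝓘(ℝ, ℝ) ψ x v := by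
  have : FiniteDimensional ℝ (TangentSpace 𝓘(ℝ, E) x) := inferInstanceAs (FiniteDimensional ℝ E)
  have : CompleteSpace (TangentSpace 𝓘(ℝ, E) x) :=
    FiniteDimensional.complete ℝ (TangentSpace 𝓘(ℝ, E) x)
  exact InnerProductSpace.toDual_symm_apply

/-- The gradient of an invariant function is equivariant: `∇ψ(gx) = dg(∇ψ(x))`. -/
theorem riemannianGradient_smul
    (hs : ∀ g : G, ContMDiff 𝓘(ℝ, E) 𝓘(ℝ, E) ∞ (fun y : M => g • y))
    (hiso : IsIsometricAction (E := E) (M := M) G)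
    (g : G) {ψ : M → ℝ} {x : M} (hψ : MDifferentiableAt 𝓘(ℝ, E) 𝓘(ℝ, ℝ) ψ (g • x))
    (hinv : (fun y => ψ (g • y)) =ᶠ[𝓝 x] ψ) :
    riemannianGradient (E := E) ψ (g • x)
      = mfderiv 𝓘(ℝ, E) 𝓘(ℝ, E) (fun y : M => g • y) x (riemannianGradient (E := E) ψ x) := by
  refine ext_inner_right ℝ fun w => ?_
  obtain ⟨v, rfl⟩ := mfderiv_translation_surjective hs g x w
  have h := mfderiv_comp x hψ ((hs g).mdifferentiable (by simp) x)
  have h' : mfderiv 𝓘(ℝ, E) 𝓘(ℝ, ℝ) (ψ ∘ fun y : M => g • y) x = mfderiv 𝓘(ℝ, E) 𝓘(ℝ, ℝ) ψ x :=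
    hinv.mfderiv_eq
  rw [hiso g x, inner_riemannianGradient, inner_riemannianGradient, ← h', h]
  rfl

end Gradient

section Submersion

/-- A map whose differential at `x` is surjective is open at `x`. -/
theorem nhds_le_map_nhds_of_surjective_mfderiv
    {E : Type*} [NormedAddCommGroup E] [NormedSpace ℝ E] [CompleteSpace E]
    {H : Type*} [TopologicalSpace H] {I : ModelWithCorners ℝ E H} [I.Boundaryless]
    {N : Type*} [TopologicalSpace N] [ChartedSpace H N] [IsManifold I 1 N]
    {E' : Type*} [NormedAddCommGroup E'] [NormedSpace ℝ E'] [CompleteSpace E']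
    {H' : Type*} [TopologicalSpace H'] {J : ModelWithCorners ℝ E' H'} [J.Boundaryless]
    {M : Type*} [TopologicalSpace M] [ChartedSpace H' M] [IsManifold J 1 M]
    {f : N → M} {x : N} (hf : ContMDiffAt I J 1 f x)
    (hsurj : Function.Surjective (mfderiv I J f x)) :
    𝓝 (f x) ≤ Filter.map f (𝓝 x) := by
  have hd := (contMDiffAt_iff.1 hf).2
  rw [I.range_eq_univ, contDiffWithinAt_univ] at hd
  have hst := hd.hasStrictFDerivAt (by simp)
  have hm : mfderiv I J f x = fderiv ℝ (writtenInExtChartAt I J x f) (extChartAt I x x) := by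
    rw [(hf.mdifferentiableAt (by simp)).mfderiv, I.range_eq_univ, fderivWithin_univ]
  rw [hm] at hsurj
  have hmap := hst.map_nhds_eq_of_surj (LinearMap.range_eq_top.2 hsurj)
  have hx : Filter.map (extChartAt I x).symm (𝓝 (extChartAt I x x)) = 𝓝 x := by
    have := map_extChartAt_symm_nhdsWithin_range (I := I) x
    rwa [I.range_eq_univ, nhdsWithin_univ] at this
  have hy : Filter.map (extChartAt J (f x)).symm (𝓝 (extChartAt J (f x) (f x))) = 𝓝 (f x) := by
    have := map_extChartAt_symm_nhdsWithin_range (I := J) (f x)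
    rwa [J.range_eq_univ, nhdsWithin_univ] at this
  simp only [Function.comp_apply, extChartAt_to_inv] at hmap
  rw [← hy, ← hmap, ← hx, Filter.map_map, Filter.map_map]
  refine (Filter.map_congr ?_).le
  have hc : ContinuousAt (f ∘ (extChartAt I x).symm) (extChartAt I x x) :=
    ContinuousAt.comp (by simpa using hf.continuousAt) (continuousAt_extChartAt_symm x)
  have hev : ∀ᶠ z in 𝓝 (extChartAt I x x),
      (f ∘ (extChartAt I x).symm) z ∈ (extChartAt J (f x)).source :=
    hc.eventually_mem (by simpa using extChartAt_source_mem_nhds (I := J) (f x))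
  filter_upwards [hev] with z hz
  exact (extChartAt J (f x)).left_inv hz

end Submersion

section Tube

theorem smul_mem_tube {M G : Type*} [Group G] [MulAction G M] {A : Set M} (g : G) {x : M}
    (hx : x ∈ tube G A) : g • x ∈ tube G A := by
  obtain ⟨h, y, hy, rfl⟩ := hx
  exact ⟨g * h, y, hy, (mul_smul g h y).symm⟩

variable {E : Type*} [NormedAddCommGroup E] [NormedSpace ℝ E] [FiniteDimensional ℝ E]
  {M : Type*} [TopologicalSpace M] [ChartedSpace E M] [IsManifold 𝓘(ℝ, E) ∞ M]
  {L : Type*} [NormedAddCommGroup L] [NormedSpace ℝ L] [FiniteDimensional ℝ L]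
  {G : Type*} [Group G] [TopologicalSpace G] [ChartedSpace L G] [LieGroup 𝓘(ℝ, L) ∞ G]
  [MulAction G M] [ContMDiffSMul 𝓘(ℝ, L) 𝓘(ℝ, E) ∞ G M]
  {F : Type*} [NormedAddCommGroup F] [NormedSpace ℝ F] [FiniteDimensional ℝ F]
  {S : Type*} [TopologicalSpace S] [ChartedSpace F S] [IsManifold 𝓘(ℝ, F) ∞ S]

/-- The tube of a slice is open, because `(g, s) ↦ g • s` is a submersion at the points
`(1, s)`. -/
theorem IsSlice.isOpen_tube {ι : S → M} {s₀ : S}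
    (h : IsSlice (E := E) (L := L) G (F := F) ι s₀) : IsOpen (tube G (Set.range ι)) := by
  have hsm : ContMDiff (𝓘(ℝ, L).prod 𝓘(ℝ, F)) 𝓘(ℝ, E) ∞ (fun p : G × S => p.1 • ι p.2) :=
    contMDiff_fst.smul (I := 𝓘(ℝ, L)) (h.isSmoothEmbedding.contMDiff.comp contMDiff_snd)
  have : ContinuousConstSMul G M :=
    ⟨fun g => (ContMDiffSMul.contMDiff_const_smul (I := 𝓘(ℝ, L)) (I' := 𝓘(ℝ, E)) (n := ∞)
      g).continuous⟩
  have hι : ∀ s, tube G (Set.range ι) ∈ 𝓝 (ι s) := by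
    intro s
    obtain ⟨Φ, hΦ⟩ : ∃ Φ : G × S → M, Φ = fun p => p.1 • ι p.2 := ⟨_, rfl⟩
    rw [← hΦ] at hsm
    have h1 : MDifferentiableAt (𝓘(ℝ, L).prod 𝓘(ℝ, F)) 𝓘(ℝ, E) Φ (1, s) :=
      hsm.mdifferentiable (by simp) _
    have hsurj : Function.Surjective (mfderiv (𝓘(ℝ, L).prod 𝓘(ℝ, F)) 𝓘(ℝ, E) Φ (1, s)) := by
      have ha := mfderiv_comp (1 : G) h1 (f := fun g : G => (g, s)) (I := 𝓘(ℝ, L))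
        (mdifferentiableAt_id.prodMk mdifferentiableAt_const)
      have hb := mfderiv_comp s h1 (f := fun s : S => ((1 : G), s)) (I := 𝓘(ℝ, F))
        (mdifferentiableAt_const.prodMk mdifferentiableAt_id)
      have ha' : (Φ ∘ fun g : G => (g, s)) = fun g => g • ι s := by rw [hΦ]; rfl
      have hb' : (Φ ∘ fun s : S => ((1 : G), s)) = ι := by
        ext s
        rw [hΦ]
        exact one_smul G (ι s)
      rw [ha'] at ha
      rw [hb'] at hb
      have hmem : ∀ w : TangentSpace 𝓘(ℝ, E) (ι s), w ∈ orbitTangent (E := E) (L := L) G (ι s) ⊔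
          LinearMap.range (mfderiv 𝓘(ℝ, F) 𝓘(ℝ, E) ι s).toLinearMap :=
        fun w => h.sup_eq_top s ▸ Submodule.mem_top
      intro w
      obtain ⟨a, ⟨l, rfl⟩, b, ⟨f, rfl⟩, hw⟩ := Submodule.mem_sup.1 (hmem w)
      refine ⟨mfderiv 𝓘(ℝ, L) (𝓘(ℝ, L).prod 𝓘(ℝ, F)) (fun g : G => (g, s)) 1 l
        + mfderiv 𝓘(ℝ, F) (𝓘(ℝ, L).prod 𝓘(ℝ, F)) (fun s : S => ((1 : G), s)) s f, ?_⟩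
      rw [map_add]
      exact Eq.trans (congrArg₂ (fun x y : E => x + y) (DFunLike.congr_fun ha l).symm
        (DFunLike.congr_fun hb f).symm) hw
    have h2 := nhds_le_map_nhds_of_surjective_mfderiv
      (hsm.contMDiffAt.of_le (by norm_cast)) hsurj
    simp only [hΦ, one_smul] at h2
    refine Filter.mem_of_superset (h2 (Filter.image_mem_map Filter.univ_mem)) ?_
    rintro _ ⟨⟨g, s⟩, -, rfl⟩
    exact ⟨g, ι s, ⟨s, rfl⟩, rfl⟩
  refine isOpen_iff_mem_nhds.2 ?_
  rintro _ ⟨g, _, ⟨s, rfl⟩, rfl⟩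
  have hc : ContinuousAt (fun y : M => g⁻¹ • y) (g • ι s) :=
    (continuous_const_smul g⁻¹).continuousAt
  have := hc.preimage_mem_nhds (t := tube G (Set.range ι)) (by simpa using hι s)
  refine Filter.mem_of_superset this fun y hy => ?_
  simpa using smul_mem_tube g hy

end Tube

/-! ### The constant rank theorem -/

section ConstantRank

open Module

/-- A form of the constant rank theorem: near `a`, the image of a smooth map `f` of constant rank
`dim V` is the graph of a smooth map `h`, in the sense that a linear projection `pr` onto `V` is a
coordinate system on this image with inverse `h`. -/
theorem exists_section_of_constant_rank
    {L : Type*} [NormedAddCommGroup L] [NormedSpace ℝ L] [FiniteDimensional ℝ L]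
    {E : Type*} [NormedAddCommGroup E] [NormedSpace ℝ E] [FiniteDimensional ℝ E]
    {V : Type*} [NormedAddCommGroup V] [NormedSpace ℝ V] [FiniteDimensional ℝ V]
    {f : L → E} {Ω : Set L} (hΩ : IsOpen Ω) (hf : ContDiffOn ℝ ∞ f Ω) {a : L} (ha : a ∈ Ω)
    (hrank : ∀ l ∈ Ω, finrank ℝ (LinearMap.range (fderiv ℝ f l).toLinearMap) = finrank ℝ V) :
    ∃ (pr : E →L[ℝ] V) (h : V → E) (B : Set V) (N : Set L), IsOpen B ∧ IsOpen N ∧ a ∈ N ∧ N ⊆ Ω ∧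
      ContDiffOn ℝ ∞ h B ∧ (∀ r ∈ B, pr (h r) = r) ∧
      (∀ l ∈ N, pr (f l) ∈ B ∧ h (pr (f l)) = f l) ∧ (∀ r ∈ B, ∃ l ∈ N, pr (f l) = r) := by
  let D : L →ₗ[ℝ] E := (fderiv ℝ f a).toLinearMap
  obtain ⟨P, hP⟩ := (LinearMap.range D).subtype.exists_leftInverse_of_injective
    (LinearMap.range D).ker_subtype
  obtain ⟨Q, hQ⟩ := (LinearMap.ker D).subtype.exists_leftInverse_of_injective
    (LinearMap.ker D).ker_subtype
  let A : LinearMap.range D ≃ₗ[ℝ] V := LinearEquiv.ofFinrankEq _ _ (hrank a ha)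
  let pr : E →L[ℝ] V := LinearMap.toContinuousLinearMap (A.toLinearMap ∘ₗ P)
  let q : L →L[ℝ] LinearMap.ker D := LinearMap.toContinuousLinearMap Q
  -- `Ψ` straightens the fibres of `f`: its first component is `pr ∘ f`, its second one a projection
  -- onto the kernel of the derivative at `a`.
  let Ψ : L → V × LinearMap.ker D := fun l => (pr (f l), q l)
  have hΨ : ContDiffOn ℝ ∞ Ψ Ω := (pr.contDiff.comp_contDiffOn hf).prodMk q.contDiff.contDiffOn
  have hfd : ∀ l ∈ Ω, HasFDerivAt f (fderiv ℝ f l) l := fun l hl =>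
    ((hf.contDiffAt (hΩ.mem_nhds hl)).differentiableAt (by simp)).hasFDerivAt
  have hΨd : ∀ l ∈ Ω, HasFDerivAt Ψ ((pr.comp (fderiv ℝ f l)).prod q) l := fun l hl =>
    (pr.hasFDerivAt.comp l (hfd l hl)).prodMk q.hasFDerivAt
  have hinj : Function.Injective ((pr.comp (fderiv ℝ f a)).prod q).toLinearMap := by
    rw [← LinearMap.ker_eq_bot, LinearMap.ker_eq_bot']
    intro v hv
    have hv1 : A (P (D v)) = 0 := congrArg Prod.fst hv
    have hv2 : Q v = 0 := congrArg Prod.snd hv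
    have h1 : P (D v) = ⟨D v, v, rfl⟩ := DFunLike.congr_fun hP ⟨D v, v, rfl⟩
    have h2 : D v = 0 := by
      have := A.map_eq_zero_iff.1 hv1
      rw [h1] at this
      exact congrArg Subtype.val this
    have h3 : Q v = ⟨v, h2⟩ := DFunLike.congr_fun hQ ⟨v, h2⟩
    rw [h3] at hv2
    exact congrArg Subtype.val hv2
  have hdim : finrank ℝ L = finrank ℝ (V × LinearMap.ker D) := by
    rw [finrank_prod, ← hrank a ha]
    exact (LinearMap.finrank_range_add_finrank_ker D).symm
  let T : L ≃L[ℝ] V × LinearMap.ker D :=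
    (LinearEquiv.ofInjectiveOfFinrankEq _ hinj hdim).toContinuousLinearEquiv
  have hT : (T : L →L[ℝ] V × LinearMap.ker D) = (pr.comp (fderiv ℝ f a)).prod q := by
    ext v <;> rfl
  have hΨa : ContDiffAt ℝ ∞ Ψ a := hΨ.contDiffAt (hΩ.mem_nhds ha)
  have hTa : HasFDerivAt Ψ (T : L →L[ℝ] V × LinearMap.ker D) a := hT ▸ hΨd a ha
  let Φ₀ := hΨa.toOpenPartialHomeomorph Ψ hTa (by simp)
  have hΩ'nhds : Ω ∩ {l | ∃ T' : L ≃L[ℝ] V × LinearMap.ker D,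
      (T' : L →L[ℝ] V × LinearMap.ker D) = fderiv ℝ Ψ l} ∈ 𝓝 a := by
    refine Filter.inter_mem (hΩ.mem_nhds ha) ?_
    have hc : ContinuousAt (fderiv ℝ Ψ) a :=
      (hΨa.fderiv_right (m := 0) (by norm_num)).continuousAt
    refine hc.preimage_mem_nhds (t := Set.range ((↑) : (L ≃L[ℝ] V × LinearMap.ker D) →
      (L →L[ℝ] V × LinearMap.ker D))) ?_
    rw [hTa.fderiv]
    exact ContinuousLinearEquiv.nhds T
  obtain ⟨Ω', hΩ'sub, hΩ'o, haΩ'⟩ := mem_nhds_iff.1 hΩ'nhds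
  let Φ := Φ₀.restrOpen Ω' hΩ'o
  have hΦsrc : Φ.source ⊆ Ω' := fun l hl => hl.2
  have haΦ : a ∈ Φ.source := ⟨hΨa.mem_toOpenPartialHomeomorph_source hTa (by simp), haΩ'⟩
  have hsymm : ∀ z ∈ Φ.target, ContDiffAt ℝ ∞ Φ.symm z := by
    intro z hz
    have hl := hΩ'sub (hΦsrc (Φ.map_target hz))
    obtain ⟨T', hT'⟩ := hl.2
    have hd := (hΨd _ hl.1).differentiableAt.hasFDerivAt
    rw [← hT'] at hd
    exact Φ.contDiffAt_symm hz hd (hΨ.contDiffAt (hΩ.mem_nhds hl.1))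
  have htgt : Φ.target ∈ 𝓝 (pr (f a)) ×ˢ 𝓝 (q a) := by
    rw [← nhds_prod_eq]
    exact Φ.open_target.mem_nhds (Φ.map_source haΦ)
  obtain ⟨B₀, hB₀, C₀, hC₀, hBC₀⟩ := Filter.mem_prod_iff.1 htgt
  obtain ⟨B, hBB₀, hB, haB⟩ := mem_nhds_iff.1 hB₀
  obtain ⟨ε, hε, hC⟩ := Metric.mem_nhds_iff.1 hC₀
  have hBC : ∀ r ∈ B, ∀ k ∈ Metric.ball (q a) ε, (r, k) ∈ Φ.target :=
    fun r hr k hk => hBC₀ ⟨hBB₀ hr, hC hk⟩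
  have hka : q a ∈ Metric.ball (q a) ε := Metric.mem_ball_self hε
  let g : V × LinearMap.ker D → E := fun z => f (Φ.symm z)
  have hmem : ∀ z ∈ Φ.target, Φ.symm z ∈ Ω := fun z hz => (hΩ'sub (hΦsrc (Φ.map_target hz))).1
  have hg : ∀ z ∈ Φ.target, ContDiffAt ℝ ∞ g z := fun z hz =>
    (hf.contDiffAt (hΩ.mem_nhds (hmem z hz))).comp z (hsymm z hz)
  have hprg : ∀ z ∈ Φ.target, pr (g z) = z.1 := fun z hz => congrArg Prod.fst (Φ.right_inv hz)
  -- Since `f` has rank `dim V`, the derivative of `g` is determined by its composition with `pr`.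
  have hgk : ∀ z ∈ Φ.target, ∀ k, fderiv ℝ g z (0, k) = 0 := by
    intro z hz k
    have hdg : HasFDerivAt g (fderiv ℝ g z) z := ((hg z hz).differentiableAt (by simp)).hasFDerivAt
    have hds : HasFDerivAt Φ.symm (fderiv ℝ Φ.symm z) z :=
      ((hsymm z hz).differentiableAt (by simp)).hasFDerivAt
    have h1 : fderiv ℝ g z = (fderiv ℝ f (Φ.symm z)).comp (fderiv ℝ Φ.symm z) :=
      hdg.unique ((hfd _ (hmem z hz)).comp z hds)
    have h2 : pr.comp (fderiv ℝ g z) = ContinuousLinearMap.fst ℝ V (LinearMap.ker D) := by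
      refine (pr.hasFDerivAt.comp z hdg).unique (hasFDerivAt_fst.congr_of_eventuallyEq ?_)
      filter_upwards [Φ.open_target.mem_nhds hz] with y hy using hprg y hy
    let R := LinearMap.range (fderiv ℝ f (Φ.symm z)).toLinearMap
    have hsurj : Function.Surjective (pr.toLinearMap.domRestrict R) := by
      intro v
      refine ⟨⟨fderiv ℝ g z (v, 0), fderiv ℝ Φ.symm z (v, 0), ?_⟩, ?_⟩
      · rw [h1]; rfl
      · exact DFunLike.congr_fun h2 (v, 0)
    have hinj' := (LinearMap.injective_iff_surjective_of_finrank_eq_finrank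
      (hrank _ (hmem z hz))).2 hsurj
    have hr : fderiv ℝ g z (0, k) ∈ R := ⟨fderiv ℝ Φ.symm z (0, k), by rw [h1]; rfl⟩
    have h0 : pr.toLinearMap.domRestrict R ⟨_, hr⟩ = pr.toLinearMap.domRestrict R 0 := by
      rw [map_zero]
      exact DFunLike.congr_fun h2 (0, k)
    exact congrArg Subtype.val (hinj' h0)
  have hconst : ∀ r ∈ B, ∀ k ∈ Metric.ball (q a) ε, g (r, k) = g (r, q a) := by
    intro r hr k hk
    have hd : ∀ k ∈ Metric.ball (q a) ε, HasFDerivAt (fun k => g (r, k))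
        (0 : LinearMap.ker D →L[ℝ] E) k := by
      intro k hk
      have hdg := ((hg _ (hBC r hr k hk)).differentiableAt (by simp)).hasFDerivAt
      have h := hdg.comp k ((hasFDerivAt_const r k).prodMk (hasFDerivAt_id k))
      refine h.congr_fderiv ?_
      ext v
      exact hgk _ (hBC r hr k hk) v
    exact (convex_ball (q a) ε).is_const_of_fderivWithin_eq_zero (𝕜 := ℝ)
      (fun k hk => (hd k hk).differentiableAt.differentiableWithinAt)
      (fun k hk => ((hd k hk).hasFDerivWithinAt.fderivWithin
        (Metric.isOpen_ball.uniqueDiffWithinAt hk))) hk hka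
  refine ⟨pr, fun r => g (r, q a), B, Φ.source ∩ Φ ⁻¹' (B ×ˢ Metric.ball (q a) ε), hB,
    Φ.isOpen_inter_preimage (hB.prod Metric.isOpen_ball), ⟨haΦ, haB, hka⟩,
    fun l hl => (hΩ'sub (hΦsrc hl.1)).1, ?_, ?_, ?_, ?_⟩
  · intro r hr
    exact ((hg _ (hBC r hr _ hka)).comp r
      (contDiffAt_id.prodMk contDiffAt_const)).contDiffWithinAt
  · exact fun r hr => hprg _ (hBC r hr _ hka)
  · rintro l ⟨hl, hl1, hl2⟩
    refine ⟨hl1, ?_⟩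
    exact (hconst _ hl1 _ hl2).symm.trans (congrArg f (Φ.left_inv hl))
  · intro r hr
    have hz := hBC r hr _ hka
    refine ⟨Φ.symm (r, q a), ⟨Φ.map_target hz, ?_⟩, hprg _ hz⟩
    rw [Set.mem_preimage, Φ.right_inv hz]
    exact ⟨hr, hka⟩

end ConstantRank

/-! ### Parametrizations of orbits -/

section AdaptedParametrization

variable {E : Type*} [NormedAddCommGroup E] [NormedSpace ℝ E]
  {M : Type*} [TopologicalSpace M] [ChartedSpace E M]

/-- A local parametrization `φ : U → S` together with a smooth map `ρ`, defined on an open subset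
`W` of the ambient manifold, which is a left inverse of `φ`. It makes transition maps between
parametrizations of `S` smooth for a trivial reason. -/
structure IsAdaptedParametrization (m : ℕ) (S : Set M) (φ : EuclideanSpace ℝ (Fin m) → M)
    (U : Set (EuclideanSpace ℝ (Fin m))) (ρ : M → EuclideanSpace ℝ (Fin m)) (W : Set M) : Prop
    extends IsLocalParametrization (E := E) m S φ U where
  isOpen_domain : IsOpen W
  contMDiffOn_leftInverse : ContMDiffOn 𝓘(ℝ, E) 𝓘(ℝ, EuclideanSpace ℝ (Fin m)) ∞ ρ W
  mem_domain : ∀ u ∈ U, φ u ∈ W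
  leftInverse : ∀ u ∈ U, ρ (φ u) = u

/-- A smooth map with a smooth local left inverse is an immersion and an embedding, so that only the
openness of its image in `S` has to be checked. -/
theorem isAdaptedParametrization_of_leftInverse {m : ℕ} {S : Set M}
    {φ : EuclideanSpace ℝ (Fin m) → M} {U : Set (EuclideanSpace ℝ (Fin m))}
    {ρ : M → EuclideanSpace ℝ (Fin m)} {W : Set M} (hU : IsOpen U)
    (hφ : ContMDiffOn 𝓘(ℝ, EuclideanSpace ℝ (Fin m)) 𝓘(ℝ, E) ∞ φ U) (hW : IsOpen W)
    (hρ : ContMDiffOn 𝓘(ℝ, E) 𝓘(ℝ, EuclideanSpace ℝ (Fin m)) ∞ ρ W) (hUW : ∀ u ∈ U, φ u ∈ W)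
    (hρφ : ∀ u ∈ U, ρ (φ u) = u) (hopen : ∃ V : Set M, IsOpen V ∧ φ '' U = V ∩ S) :
    IsAdaptedParametrization (E := E) m S φ U ρ W where
  isOpen := hU
  contMDiffOn := hφ
  injective_mfderiv := by
    intro u hu
    have h := mfderiv_comp u
      ((hρ.contMDiffAt (hW.mem_nhds (hUW u hu))).mdifferentiableAt (by simp))
      ((hφ.contMDiffAt (hU.mem_nhds hu)).mdifferentiableAt (by simp))
    have hid : ρ ∘ φ =ᶠ[𝓝 u] id := by
      filter_upwards [hU.mem_nhds hu] with z hz using hρφ z hz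
    rw [hid.mfderiv_eq, mfderiv_id] at h
    intro v w hvw
    exact (DFunLike.congr_fun h v).trans
      ((congrArg (mfderiv 𝓘(ℝ, E) 𝓘(ℝ, EuclideanSpace ℝ (Fin m)) ρ (φ u)) hvw).trans
        (DFunLike.congr_fun h w).symm)
  isEmbedding := by
    have hc : Continuous (U.domRestrict φ) := continuousOn_iff_continuous_domRestrict.1
      hφ.continuousOn
    have hk : Continuous (fun u : U => (⟨φ u, hUW u u.2⟩ : W)) := hc.subtype_mk _
    have hr : Continuous (W.domRestrict ρ) := continuousOn_iff_continuous_domRestrict.1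
      hρ.continuousOn
    have hcomp : (W.domRestrict ρ) ∘ (fun u : U => (⟨φ u, hUW u u.2⟩ : W)) = Subtype.val := by
      ext1 u
      exact hρφ u u.2
    exact Topology.IsEmbedding.subtypeVal.comp
      (Topology.IsEmbedding.of_comp hk hr (by
        rw [hcomp]
        exact Topology.IsEmbedding.subtypeVal))
  isOpen_image := hopen
  isOpen_domain := hW
  contMDiffOn_leftInverse := hρ
  mem_domain := hUW
  leftInverse := hρφ

theorem IsAdaptedParametrization.mono {m : ℕ} {S : Set M}
    {φ : EuclideanSpace ℝ (Fin m) → M} {U U' : Set (EuclideanSpace ℝ (Fin m))}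
    {ρ : M → EuclideanSpace ℝ (Fin m)} {W : Set M}
    (h : IsAdaptedParametrization (E := E) m S φ U ρ W) (hU' : IsOpen U') (hsub : U' ⊆ U) :
    IsAdaptedParametrization (E := E) m S φ U' ρ W := by
  refine isAdaptedParametrization_of_leftInverse hU' (h.contMDiffOn.mono hsub) h.isOpen_domain
    h.contMDiffOn_leftInverse (fun u hu => h.mem_domain u (hsub hu))
    (fun u hu => h.leftInverse u (hsub hu)) ?_
  obtain ⟨V, hV, hVS⟩ := h.isOpen_image
  refine ⟨V ∩ (W ∩ ρ ⁻¹' U'), hV.inter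
    (h.contMDiffOn_leftInverse.continuousOn.isOpen_inter_preimage h.isOpen_domain hU'), ?_⟩
  ext y
  constructor
  · rintro ⟨u, hu, rfl⟩
    have := hVS ▸ Set.mem_image_of_mem φ (hsub hu)
    refine ⟨⟨this.1, h.mem_domain u (hsub hu), ?_⟩, this.2⟩
    rw [Set.mem_preimage, h.leftInverse u (hsub hu)]
    exact hu
  · rintro ⟨⟨hyV, hyW, hyU⟩, hyS⟩
    obtain ⟨u, hu, rfl⟩ : y ∈ φ '' U := hVS ▸ ⟨hyV, hyS⟩
    rw [Set.mem_preimage, h.leftInverse u hu] at hyU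
    exact ⟨u, hyU, rfl⟩

variable {G : Type*} [Group G] [MulAction G M]

theorem IsLocalParametrization.smul
    (hs : ∀ g : G, ContMDiff 𝓘(ℝ, E) 𝓘(ℝ, E) ∞ (fun y : M => g • y)) (g : G) {m : ℕ} {x : M}
    {φ : EuclideanSpace ℝ (Fin m) → M} {U : Set (EuclideanSpace ℝ (Fin m))}
    (h : IsLocalParametrization (E := E) m (MulAction.orbit G x) φ U) :
    IsLocalParametrization (E := E) m (MulAction.orbit G x) (fun u => g • φ u) U where
  isOpen := h.isOpen
  contMDiffOn := (hs g).comp_contMDiffOn h.contMDiffOn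
  injective_mfderiv := by
    intro u hu
    have h1 := mfderiv_comp u ((hs g).mdifferentiable (by simp) (φ u))
      ((h.contMDiffOn.contMDiffAt (h.isOpen.mem_nhds hu)).mdifferentiableAt (by simp))
    have h2 := (mfderiv_translation_injective hs g (φ u)).comp (h.injective_mfderiv u hu)
    intro v w hvw
    refine h2 ?_
    exact (DFunLike.congr_fun h1 v).symm.trans (Eq.trans hvw (DFunLike.congr_fun h1 w))
  isEmbedding := by
    have : ContinuousConstSMul G M := ⟨fun g => (hs g).continuous⟩
    exact (Homeomorph.smul g).isEmbedding.comp h.isEmbedding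
  isOpen_image := by
    have : ContinuousConstSMul G M := ⟨fun g => (hs g).continuous⟩
    obtain ⟨V, hV, hVS⟩ := h.isOpen_image
    refine ⟨(fun y => g⁻¹ • y) ⁻¹' V, hV.preimage (continuous_const_smul g⁻¹), ?_⟩
    ext y
    constructor
    · rintro ⟨u, hu, rfl⟩
      have := hVS ▸ Set.mem_image_of_mem φ hu
      refine ⟨by simpa using this.1, ?_⟩
      exact (MulAction.mem_orbit_of_mem_orbit g this.2)
    · rintro ⟨hy, hyS⟩
      obtain ⟨u, hu, huy⟩ : g⁻¹ • y ∈ φ '' U :=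
        hVS ▸ ⟨hy, MulAction.mem_orbit_of_mem_orbit g⁻¹ hyS⟩
      exact ⟨u, hu, by simp [huy]⟩

theorem IsAdaptedParametrization.smul
    (hs : ∀ g : G, ContMDiff 𝓘(ℝ, E) 𝓘(ℝ, E) ∞ (fun y : M => g • y)) (g : G) {m : ℕ} {x : M}
    {φ : EuclideanSpace ℝ (Fin m) → M} {U : Set (EuclideanSpace ℝ (Fin m))}
    {ρ : M → EuclideanSpace ℝ (Fin m)} {W : Set M}
    (h : IsAdaptedParametrization (E := E) m (MulAction.orbit G x) φ U ρ W) :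
    IsAdaptedParametrization (E := E) m (MulAction.orbit G x) (fun u => g • φ u) U
      (fun y => ρ (g⁻¹ • y)) ((fun y => g⁻¹ • y) ⁻¹' W) where
  toIsLocalParametrization := h.toIsLocalParametrization.smul hs g
  isOpen_domain := h.isOpen_domain.preimage (hs g⁻¹).continuous
  contMDiffOn_leftInverse :=
    h.contMDiffOn_leftInverse.comp (hs g⁻¹).contMDiffOn fun _ hy => hy
  mem_domain := fun u hu => by simpa using h.mem_domain u hu
  leftInverse := fun u hu => by simpa using h.leftInverse u hu

end AdaptedParametrization

section OrbitParametrization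

theorem finrank_range_comp_comp {R : Type*} [DivisionRing R] {V₁ V₂ V₃ V₄ : Type*}
    [AddCommGroup V₁] [Module R V₁] [AddCommGroup V₂] [Module R V₂] [AddCommGroup V₃] [Module R V₃]
    [AddCommGroup V₄] [Module R V₄] {C : V₁ →ₗ[R] V₂} (B : V₂ →ₗ[R] V₃) {A : V₃ →ₗ[R] V₄}
    (hA : Function.Injective A) (hC : Function.Surjective C) :
    Module.finrank R (LinearMap.range (A ∘ₗ B ∘ₗ C)) = Module.finrank R (LinearMap.range B) := by
  rw [LinearMap.range_comp, LinearMap.range_comp_of_range_eq_top _ (LinearMap.range_eq_top.2 hC)]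
  exact (Submodule.equivMapOfInjective A hA _).finrank_eq.symm

/-- The orbit map of a compact group is open onto its image. -/
theorem exists_isOpen_orbitMap_image {G M : Type*} [Group G] [TopologicalSpace G]
    [ContinuousMul G] [CompactSpace G] [TopologicalSpace M] [T2Space M] [MulAction G M]
    [ContinuousSMul G M] (x : M) {O : Set G} (hO : IsOpen O) :
    ∃ V : Set M, IsOpen V ∧ (fun g : G => g • x) '' O = V ∩ MulAction.orbit G x := by
  have hc : Continuous (fun g : G => g • x) := continuous_id.smul continuous_const
  -- The saturation of `O` is the union of its right translates by the stabilizer.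
  have hsat : (fun g : G => g • x) ⁻¹' ((fun g : G => g • x) '' O)
      = ⋃ s ∈ MulAction.stabilizer G x, (fun g => g * s) ⁻¹' O := by
    ext g
    simp only [Set.mem_preimage, Set.mem_image, Set.mem_iUnion]
    constructor
    · rintro ⟨o, ho, hox⟩
      refine ⟨g⁻¹ * o, ?_, by simpa using ho⟩
      rw [MulAction.mem_stabilizer_iff, mul_smul, hox, inv_smul_smul]
    · rintro ⟨s, hs, ho⟩
      exact ⟨g * s, ho, by rw [mul_smul, MulAction.mem_stabilizer_iff.1 hs]⟩
  have hopen : IsOpen ((fun g : G => g • x) ⁻¹' ((fun g : G => g • x) '' O)) := by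
    rw [hsat]
    exact isOpen_biUnion fun s _ => hO.preimage (continuous_mul_const s)
  refine ⟨((fun g : G => g • x) '' ((fun g : G => g • x) ⁻¹' ((fun g : G => g • x) '' O))ᶜ)ᶜ,
    (hopen.isClosed_compl.isCompact.image hc).isClosed.isOpen_compl, ?_⟩
  ext y
  constructor
  · rintro ⟨o, ho, rfl⟩
    refine ⟨?_, ⟨o, rfl⟩⟩
    rintro ⟨g, hg, hgx⟩
    exact hg ⟨o, ho, hgx.symm⟩
  · rintro ⟨hy, ⟨g, rfl⟩⟩
    by_contra hn
    exact hy ⟨g, hn, rfl⟩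

variable {E : Type*} [NormedAddCommGroup E] [NormedSpace ℝ E]
  {M : Type*} [TopologicalSpace M] [ChartedSpace E M]
  {L : Type*} [NormedAddCommGroup L] [NormedSpace ℝ L]
  {G : Type*} [Group G] [TopologicalSpace G] [ChartedSpace L G]
  [MulAction G M] [ContMDiffSMul 𝓘(ℝ, L) 𝓘(ℝ, E) ∞ G M]

theorem contMDiff_orbitMap (x : M) :
    ContMDiff 𝓘(ℝ, L) 𝓘(ℝ, E) ∞ (fun g : G => g • x) :=
  contMDiff_id.smul (I := 𝓘(ℝ, L)) contMDiff_const

/-- The orbit map has constant rank, because it intertwines the translations of the group with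
those of the manifold. -/
theorem finrank_range_mfderiv_orbitMap [LieGroup 𝓘(ℝ, L) ∞ G] (x : M) (g : G) :
    Module.finrank ℝ (LinearMap.range
        (mfderiv 𝓘(ℝ, L) 𝓘(ℝ, E) (fun g : G => g • x) g).toLinearMap)
      = Module.finrank ℝ (orbitTangent (E := E) (L := L) G x) := by
  have hs : ∀ g : G, ContMDiff 𝓘(ℝ, E) 𝓘(ℝ, E) ∞ (fun y : M => g • y) :=
    fun g => ContMDiffSMul.contMDiff_const_smul (I := 𝓘(ℝ, L)) g
  have hsG : ∀ g : G, ContMDiff 𝓘(ℝ, L) 𝓘(ℝ, L) ∞ (fun y : G => g • y) :=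
    fun g => ContMDiffSMul.contMDiff_const_smul (I := 𝓘(ℝ, L)) g
  have hf := (contMDiff_orbitMap (E := E) (L := L) (G := G) x).mdifferentiable (by simp)
  have h1 := mfderiv_comp g (f := fun h : G => g⁻¹ • h) (hf (g⁻¹ • g))
    ((hsG g⁻¹).mdifferentiable (by simp) g)
  have h2 := mfderiv_comp g (f := (fun h : G => h • x) ∘ fun h : G => g⁻¹ • h)
    ((hs g).mdifferentiable (by simp) _)
    ((hf (g⁻¹ • g)).comp g ((hsG g⁻¹).mdifferentiable (by simp) g))
  have h3 : (fun y : M => g • y) ∘ ((fun h : G => h • x) ∘ fun h : G => g⁻¹ • h)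
      = fun h : G => h • x := by
    ext h
    simp [mul_smul]
  rw [h3, h1] at h2
  have key := finrank_range_comp_comp (R := ℝ)
    (C := (mfderiv 𝓘(ℝ, L) 𝓘(ℝ, L) (fun h : G => g⁻¹ • h) g).toLinearMap)
    (mfderiv 𝓘(ℝ, L) 𝓘(ℝ, E) (fun g : G => g • x) (g⁻¹ • g)).toLinearMap
    (A := (mfderiv 𝓘(ℝ, E) 𝓘(ℝ, E) (fun y : M => g • y) ((g⁻¹ • g) • x)).toLinearMap)
    (mfderiv_translation_injective hs g _) (mfderiv_translation_surjective hsG g⁻¹ g)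
  have h4 : g⁻¹ • g = 1 := inv_mul_cancel g
  exact (congrArg (fun T : L →L[ℝ] E => Module.finrank ℝ (LinearMap.range T.toLinearMap)) h2).trans
    (key.trans (congrArg (fun h : G => Module.finrank ℝ (LinearMap.range
      (mfderiv 𝓘(ℝ, L) 𝓘(ℝ, E) (fun g : G => g • x) h).toLinearMap)) h4))

/-- The orbits of a compact Lie group are embedded submanifolds, of the dimension of their tangent
spaces: near `x`, the image of the orbit map is parametrized using the constant rank theorem. -/
theorem exists_isAdaptedParametrization_orbit [FiniteDimensional ℝ E] [FiniteDimensional ℝ L]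
    [IsManifold 𝓘(ℝ, E) ∞ M] [T2Space M] [CompactSpace G] [LieGroup 𝓘(ℝ, L) ∞ G] (x : M) :
    ∃ φ U ρ W, IsAdaptedParametrization (E := E)
      (Module.finrank ℝ (orbitTangent (E := E) (L := L) G x)) (MulAction.orbit G x) φ U ρ W ∧
        x ∈ φ '' U := by
  have : ContinuousSMul G M := ContMDiffSMul.continuousSMul (I := 𝓘(ℝ, L)) (I' := 𝓘(ℝ, E)) ∞
  have : ContinuousMul G := continuousMul_of_contMDiffMul 𝓘(ℝ, L) ∞
  have hf := contMDiff_orbitMap (E := E) (L := L) (G := G) x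
  obtain ⟨f, hfdef⟩ : ∃ f : G → M, f = fun g => g • x := ⟨_, rfl⟩
  rw [← hfdef] at hf
  let c := chartAt L (1 : G)
  let e := chartAt E x
  have hc : c ∈ IsManifold.maximalAtlas 𝓘(ℝ, L) ∞ G := IsManifold.chart_mem_maximalAtlas _
  have he : e ∈ IsManifold.maximalAtlas 𝓘(ℝ, E) ∞ M := IsManifold.chart_mem_maximalAtlas _
  have h1c : (1 : G) ∈ c.source := mem_chart_source L _
  have hxe : x ∈ e.source := mem_chart_source E _
  have hf1 : f 1 = x := by rw [hfdef]; exact one_smul G x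
  let Ω : Set L := c.target ∩ c.symm ⁻¹' (f ⁻¹' e.source)
  have hΩ : IsOpen Ω := c.symm.isOpen_inter_preimage (e.open_source.preimage hf.continuous)
  have hcs := contMDiffOn_symm_of_mem_maximalAtlas hc
  have hes := contMDiffOn_of_mem_maximalAtlas he
  have hF : ContDiffOn ℝ ∞ (fun l => e (f (c.symm l))) Ω :=
    (hes.comp (hf.comp_contMDiffOn (hcs.mono Set.inter_subset_left))
      fun l hl => hl.2).contDiffOn
  have h1Ω : c 1 ∈ Ω := by
    refine ⟨c.map_source h1c, ?_⟩
    rw [Set.mem_preimage, c.left_inv h1c, Set.mem_preimage, hf1]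
    exact hxe
  have hrank : ∀ l ∈ Ω, Module.finrank ℝ (LinearMap.range
      (fderiv ℝ (fun l => e (f (c.symm l))) l).toLinearMap)
      = Module.finrank ℝ (EuclideanSpace ℝ
        (Fin (Module.finrank ℝ (orbitTangent (E := E) (L := L) G x)))) := by
    intro l hl
    have hcd := mdifferentiable_chart (I := 𝓘(ℝ, L)) (1 : G)
    have hed := mdifferentiable_chart (I := 𝓘(ℝ, E)) x
    have hfd : MDifferentiableAt 𝓘(ℝ, L) 𝓘(ℝ, E) f (c.symm l) := hf.mdifferentiable (by simp) _
    have hcd' : MDifferentiableAt 𝓘(ℝ, L) 𝓘(ℝ, L) c.symm l := hcd.mdifferentiableAt_symm hl.1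
    have h1 := mfderiv_comp l hfd hcd'
    have h2 := mfderiv_comp l (hed.mdifferentiableAt hl.2) (hfd.comp l hcd')
    rw [h1, mfderiv_eq_fderiv] at h2
    have key := finrank_range_comp_comp (R := ℝ)
      (C := (mfderiv 𝓘(ℝ, L) 𝓘(ℝ, L) c.symm l).toLinearMap)
      (mfderiv 𝓘(ℝ, L) 𝓘(ℝ, E) f (c.symm l)).toLinearMap
      (A := (mfderiv 𝓘(ℝ, E) 𝓘(ℝ, E) e (f (c.symm l))).toLinearMap)
      (hed.mfderiv_injective hl.2) (hcd.symm.mfderiv_surjective hl.1)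
    rw [finrank_euclideanSpace_fin, ← finrank_range_mfderiv_orbitMap x (c.symm l), ← hfdef]
    exact (congrArg (fun T : L →L[ℝ] E =>
      Module.finrank ℝ (LinearMap.range T.toLinearMap)) h2).trans key
  obtain ⟨p, h, B, N, hB, hN, h1N, hNΩ, hh, hph, hNB, hBN⟩ :=
    exists_section_of_constant_rank hΩ hF h1Ω hrank
  have hhe : ∀ r ∈ B, ∃ l ∈ N, h r = e (f (c.symm l)) ∧ r = p (e (f (c.symm l))) := by
    intro r hr
    obtain ⟨l, hl, rfl⟩ := hBN r hr
    exact ⟨l, hl, (hNB l hl).2, rfl⟩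
  have himage : ∀ r ∈ B, e.symm (h r) ∈ e.source ∧ e (e.symm (h r)) = h r := by
    intro r hr
    obtain ⟨l, hl, hr1, -⟩ := hhe r hr
    rw [hr1, e.left_inv (hNΩ hl).2]
    exact ⟨(hNΩ hl).2, rfl⟩
  refine ⟨fun r => e.symm (h r), B, fun y => p (e y), e.source,
    isAdaptedParametrization_of_leftInverse hB ?_ e.open_source ?_ ?_ ?_ ?_, ?_⟩
  · refine (contMDiffOn_symm_of_mem_maximalAtlas he).comp hh.contMDiffOn fun r hr => ?_
    obtain ⟨l, hl, hr1, -⟩ := hhe r hr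
    rw [Set.mem_preimage, hr1]
    exact e.map_source (hNΩ hl).2
  · exact p.contDiff.contMDiff.comp_contMDiffOn hes
  · exact fun r hr => (himage r hr).1
  · intro r hr
    rw [(himage r hr).2, hph r hr]
  · obtain ⟨V, hV, hVS⟩ := exists_isOpen_orbitMap_image x
      (c.isOpen_image_symm_of_subset_target hN (fun l hl => (hNΩ hl).1))
    refine ⟨V, hV, ?_⟩
    rw [← hVS, ← hfdef]
    ext y
    constructor
    · rintro ⟨r, hr, rfl⟩
      obtain ⟨l, hl, hr1, -⟩ := hhe r hr
      refine ⟨c.symm l, ⟨l, hl, rfl⟩, ?_⟩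
      change _ = e.symm (h r)
      rw [hr1, e.left_inv (hNΩ hl).2]
    · rintro ⟨_, ⟨l, hl, rfl⟩, rfl⟩
      refine ⟨p (e (f (c.symm l))), (hNB l hl).1, ?_⟩
      change e.symm (h (p (e (f (c.symm l))))) = _
      rw [(hNB l hl).2, e.left_inv (hNΩ hl).2]
  · refine ⟨p (e (f (c.symm (c 1)))), (hNB _ h1N).1, ?_⟩
    change e.symm (h (p (e (f (c.symm (c 1)))))) = _
    rw [(hNB _ h1N).2, c.left_inv h1c, hf1, e.left_inv hxe]

end OrbitParametrization

/-! ### Change of variables for the volume density -/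

section VolumeDensity

variable {E : Type*} [NormedAddCommGroup E] [NormedSpace ℝ E]
  {M : Type*} [TopologicalSpace M] [ChartedSpace E M]
  [RiemannianBundle (fun x : M => TangentSpace 𝓘(ℝ, E) x)] {m : ℕ}

/-- The matrix of a bilinear form in the standard basis. -/
def formMatrix (B : EuclideanSpace ℝ (Fin m) →L[ℝ] EuclideanSpace ℝ (Fin m) →L[ℝ] ℝ) :
    Matrix (Fin m) (Fin m) ℝ :=
  Matrix.of fun i j => B (EuclideanSpace.single i 1) (EuclideanSpace.single j 1)

theorem volumeDensity_eq (φ : EuclideanSpace ℝ (Fin m) → M) (u : EuclideanSpace ℝ (Fin m)) :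
    volumeDensity (E := E) φ u
      = ENNReal.ofReal (Real.sqrt (formMatrix (pullbackMetric (E := E) φ u)).det) := rfl

/-- Pulling a bilinear form back along `A` multiplies its Gram determinant by `(det A)^2`. -/
theorem det_formMatrix_comp
    (B B' : EuclideanSpace ℝ (Fin m) →L[ℝ] EuclideanSpace ℝ (Fin m) →L[ℝ] ℝ)
    (A : EuclideanSpace ℝ (Fin m) →L[ℝ] EuclideanSpace ℝ (Fin m))
    (h : ∀ v w, B' v w = B (A v) (A w)) :
    (formMatrix B').det = A.det ^ 2 * (formMatrix B).det := by
  let b := (EuclideanSpace.basisFun (Fin m) ℝ).toBasis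
  have hmat : ∀ C : EuclideanSpace ℝ (Fin m) →L[ℝ] EuclideanSpace ℝ (Fin m) →L[ℝ] ℝ,
      formMatrix C = LinearMap.BilinForm.toMatrix b
        (LinearMap.mk₂ ℝ (fun v w => C v w) (by simp) (by simp) (by simp) (by simp)) := by
    intro C
    ext i j
    simp [formMatrix, LinearMap.BilinForm.toMatrix_apply, b]
  have hB' : LinearMap.mk₂ ℝ (fun v w => B' v w) (by simp) (by simp) (by simp) (by simp)
      = LinearMap.BilinForm.comp
        (LinearMap.mk₂ ℝ (fun v w => B v w) (by simp) (by simp) (by simp) (by simp))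
        A.toLinearMap A.toLinearMap := by
    ext v w
    exact h v w
  have hA : A.det = (LinearMap.toMatrix b b A.toLinearMap).det :=
    (LinearMap.det_toMatrix b A.toLinearMap).symm
  rw [hmat, hB', LinearMap.BilinForm.toMatrix_comp b b, Matrix.det_mul, Matrix.det_mul,
    Matrix.det_transpose, ← hmat, hA]
  ring

/-- The tangent spaces at different points are the same type `E`, but carry different inner
products; equal points have equal ones. -/
theorem inner_congr_point {x y : M} (h : x = y) {v w : TangentSpace 𝓘(ℝ, E) x}
    {v' w' : TangentSpace 𝓘(ℝ, E) y} (hv : HEq v v') (hw : HEq w w') :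
    (inner ℝ v w : ℝ) = inner ℝ v' w' := by
  subst h
  rw [eq_of_heq hv, eq_of_heq hw]

/-- Transformation rule of the volume density under a change of parametrization. -/
theorem volumeDensity_comp {p φ : EuclideanSpace ℝ (Fin m) → M}
    {τ : EuclideanSpace ℝ (Fin m) → EuclideanSpace ℝ (Fin m)} {u : EuclideanSpace ℝ (Fin m)}
    (hp : p =ᶠ[𝓝 u] φ ∘ τ)
    (hφ : MDifferentiableAt 𝓘(ℝ, EuclideanSpace ℝ (Fin m)) 𝓘(ℝ, E) φ (τ u))
    (hτ : DifferentiableAt ℝ τ u) :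
    volumeDensity (E := E) p u
      = ENNReal.ofReal |(fderiv ℝ τ u).det| * volumeDensity (E := E) φ (τ u) := by
  have hm := mfderiv_comp u hφ hτ.mdifferentiableAt
  rw [mfderiv_eq_fderiv] at hm
  have hform : ∀ v w, pullbackMetric (E := E) p u v w
      = pullbackMetric (E := E) φ (τ u) (fderiv ℝ τ u v) (fderiv ℝ τ u w) := by
    intro v w
    have hv : ∀ v, (mfderiv 𝓘(ℝ, EuclideanSpace ℝ (Fin m)) 𝓘(ℝ, E) p u v : E)
        = mfderiv 𝓘(ℝ, EuclideanSpace ℝ (Fin m)) 𝓘(ℝ, E) φ (τ u) (fderiv ℝ τ u v) := by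
      intro v
      have h1 := DFunLike.congr_fun (hp.mfderiv_eq (I := 𝓘(ℝ, EuclideanSpace ℝ (Fin m)))
        (I' := 𝓘(ℝ, E))) v
      exact h1.trans (DFunLike.congr_fun hm v)
    rw [pullbackMetric_apply, pullbackMetric_apply]
    exact inner_congr_point hp.eq_of_nhds (heq_of_eq (hv v)) (heq_of_eq (hv w))
  rw [volumeDensity_eq, volumeDensity_eq, det_formMatrix_comp _ _ _ hform,
    Real.sqrt_mul (sq_nonneg _), Real.sqrt_sq_eq_abs, ENNReal.ofReal_mul (abs_nonneg _)]

theorem volumeDensity_pos {φ : EuclideanSpace ℝ (Fin m) → M} {u : EuclideanSpace ℝ (Fin m)}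
    (h : Function.Injective (mfderiv 𝓘(ℝ, EuclideanSpace ℝ (Fin m)) 𝓘(ℝ, E) φ u)) :
    0 < volumeDensity (E := E) φ u := by
  refine ENNReal.ofReal_pos.2 (Real.sqrt_pos.2 ?_)
  have hli : LinearIndependent ℝ (fun i : Fin m =>
      mfderiv 𝓘(ℝ, EuclideanSpace ℝ (Fin m)) 𝓘(ℝ, E) φ u (EuclideanSpace.single i (1 : ℝ))) := by
    have hb := (EuclideanSpace.basisFun (Fin m) ℝ).toBasis.linearIndependent
    have := hb.map' (mfderiv 𝓘(ℝ, EuclideanSpace ℝ (Fin m)) 𝓘(ℝ, E) φ u).toLinearMap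
      (LinearMap.ker_eq_bot.2 h)
    have hfun : (fun i : Fin m => mfderiv 𝓘(ℝ, EuclideanSpace ℝ (Fin m)) 𝓘(ℝ, E) φ u
        (EuclideanSpace.single i (1 : ℝ)))
        = (mfderiv 𝓘(ℝ, EuclideanSpace ℝ (Fin m)) 𝓘(ℝ, E) φ u).toLinearMap
          ∘ (EuclideanSpace.basisFun (Fin m) ℝ).toBasis := by
      ext i
      have hi : EuclideanSpace.single i (1 : ℝ)
          = (EuclideanSpace.basisFun (Fin m) ℝ).toBasis i := by simp
      exact congrArg (mfderiv 𝓘(ℝ, EuclideanSpace ℝ (Fin m)) 𝓘(ℝ, E) φ u) hi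
    rw [hfun]
    exact this
  exact (Matrix.posDef_gram_of_linearIndependent hli).det_pos

theorem continuousOn_volumeDensity [IsManifold 𝓘(ℝ, E) ∞ M]
    [IsContMDiffRiemannianBundle 𝓘(ℝ, E) ∞ E (fun x : M => TangentSpace 𝓘(ℝ, E) x)]
    {φ : EuclideanSpace ℝ (Fin m) → M} {U : Set (EuclideanSpace ℝ (Fin m))} (hU : IsOpen U)
    (hφ : ContMDiffOn 𝓘(ℝ, EuclideanSpace ℝ (Fin m)) 𝓘(ℝ, E) ∞ φ U) :
    ContinuousOn (volumeDensity (E := E) φ) U := by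
  have h : ContinuousOn (fun u => formMatrix (pullbackMetric (E := E) φ u)) U :=
    continuousOn_pi.2 fun i => continuousOn_pi.2 fun j =>
      (contDiffOn_inner_mfderiv hU hφ _ _).continuousOn
  have hdet : ContinuousOn (fun u => (formMatrix (pullbackMetric (E := E) φ u)).det) U :=
    Continuous.comp_continuousOn (continuous_id.matrix_det) h
  exact (ENNReal.continuous_ofReal.comp Real.continuous_sqrt).comp_continuousOn hdet

theorem volumeDensity_smul {G : Type*} [Group G] [MulAction G M]
    (hs : ∀ g : G, ContMDiff 𝓘(ℝ, E) 𝓘(ℝ, E) ∞ (fun y : M => g • y))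
    (hiso : IsIsometricAction (E := E) (M := M) G)
    (g : G) {φ : EuclideanSpace ℝ (Fin m) → M} {u : EuclideanSpace ℝ (Fin m)}
    (hφ : MDifferentiableAt 𝓘(ℝ, EuclideanSpace ℝ (Fin m)) 𝓘(ℝ, E) φ u) :
    volumeDensity (E := E) (fun u => g • φ u) u = volumeDensity (E := E) φ u := by
  rw [volumeDensity_eq, volumeDensity_eq]
  congr 4
  ext i j
  exact inner_mfderiv_smul hs hiso g hφ _ _

end VolumeDensity

section LocalVolume

variable {E : Type*} [NormedAddCommGroup E] [NormedSpace ℝ E]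
  {M : Type*} [TopologicalSpace M] [ChartedSpace E M]
  [RiemannianBundle (fun x : M => TangentSpace 𝓘(ℝ, E) x)] [MeasurableSpace M] {m : ℕ}

variable (E) in
/-- The Riemannian volume of the piece of a submanifold covered by a parametrization `φ : U → S`,
as a measure on the ambient manifold. -/
def localVolume (φ : EuclideanSpace ℝ (Fin m) → M) (U : Set (EuclideanSpace ℝ (Fin m))) :
    Measure M :=
  ((volume.restrict U).withDensity (volumeDensity (E := E) φ)).map φ

theorem localVolume_le_submanifoldVolume {S : Set M} {φ : EuclideanSpace ℝ (Fin m) → M}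
    {U : Set (EuclideanSpace ℝ (Fin m))} (h : IsLocalParametrization (E := E) m S φ U) :
    localVolume E φ U ≤ submanifoldVolume (E := E) m S :=
  le_iSup (fun p : {p : (EuclideanSpace ℝ (Fin m) → M) × Set (EuclideanSpace ℝ (Fin m)) //
    IsLocalParametrization (E := E) m S p.1 p.2} => localVolume E p.1.1 p.1.2) ⟨(φ, U), h⟩

theorem submanifoldVolume_le {S : Set M} {μ : Measure M}
    (h : ∀ (φ : EuclideanSpace ℝ (Fin m) → M) (U : Set (EuclideanSpace ℝ (Fin m))),
      IsLocalParametrization (E := E) m S φ U → localVolume E φ U ≤ μ) :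
    submanifoldVolume (E := E) m S ≤ μ :=
  iSup_le fun p => h _ _ p.2

variable [BorelSpace M]

theorem measurableSet_inter_preimage_of_continuousOn {X : Type*} [TopologicalSpace X]
    [MeasurableSpace X] [BorelSpace X] {φ : X → M} {U : Set X} (hU : IsOpen U)
    (hφ : ContinuousOn φ U) {A : Set M} (hA : MeasurableSet A) :
    MeasurableSet (U ∩ φ ⁻¹' A) := by
  have h := (continuousOn_iff_continuous_domRestrict.1 hφ).measurable hA
  have h2 := hU.measurableSet.subtype_image h
  convert h2 using 1
  ext u
  simp [and_comm]

/-- A parametrization is arbitrary off its domain, but almost everywhere measurable for the measure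
supported on it, so that the pushforward in `localVolume` is a genuine one. -/
theorem aemeasurable_withDensity_of_continuousOn [SecondCountableTopology M] [T2Space M]
    [RegularSpace M]
    {φ : EuclideanSpace ℝ (Fin m) → M} {U : Set (EuclideanSpace ℝ (Fin m))} (hU : IsOpen U)
    (hφ : ContinuousOn φ U) (f : EuclideanSpace ℝ (Fin m) → ℝ≥0∞) :
    AEMeasurable φ ((volume.restrict U).withDensity f) :=
  (hφ.aemeasurable hU.measurableSet).mono_ac (withDensity_absolutelyContinuous _ _)

variable [SecondCountableTopology M] [T2Space M] [RegularSpace M]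

theorem localVolume_apply {φ : EuclideanSpace ℝ (Fin m) → M}
    {U : Set (EuclideanSpace ℝ (Fin m))} (hU : IsOpen U) (hφ : ContinuousOn φ U) {A : Set M}
    (hA : MeasurableSet A) :
    localVolume E φ U A = ∫⁻ u in U ∩ φ ⁻¹' A, volumeDensity (E := E) φ u := by
  rw [localVolume, Measure.map_apply_of_aemeasurable
    (aemeasurable_withDensity_of_continuousOn hU hφ _) hA, withDensity_apply',
    Measure.restrict_restrict' hU.measurableSet, Set.inter_comm]

/-- Two parametrizations of a submanifold induce the same volume on the intersection of their
images. Only one of the two inequalities is needed, by the change of variables formula for the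
smooth transition map `ρ ∘ p`. -/
theorem localVolume_le_of_subset {S V : Set M} {p φ : EuclideanSpace ℝ (Fin m) → M}
    {Up U : Set (EuclideanSpace ℝ (Fin m))} {ρ : M → EuclideanSpace ℝ (Fin m)} {W : Set M}
    (hp : IsLocalParametrization (E := E) m S p Up)
    (hφ : IsAdaptedParametrization (E := E) m S φ U ρ W) (hV : IsOpen V) (hVS : φ '' U = V ∩ S)
    {A : Set M} (hA : MeasurableSet A) (hAV : A ⊆ V) :
    localVolume E p Up A ≤ localVolume E φ U A := by
  have hpS : ∀ u ∈ Up, p u ∈ S := by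
    intro u hu
    obtain ⟨V', -, hV'⟩ := hp.isOpen_image
    exact (hV' ▸ Set.mem_image_of_mem p hu : p u ∈ V' ∩ S).2
  have hpc := hp.contMDiffOn.continuousOn
  let s₀ := Up ∩ p ⁻¹' V
  have hs₀ : IsOpen s₀ := hpc.isOpen_inter_preimage hp.isOpen hV
  let τ : EuclideanSpace ℝ (Fin m) → EuclideanSpace ℝ (Fin m) := fun u => ρ (p u)
  have hτ : ∀ u ∈ s₀, p u ∈ W ∧ τ u ∈ U ∧ φ (τ u) = p u := by
    intro u hu
    obtain ⟨z, hz, hzu⟩ : p u ∈ φ '' U := hVS ▸ ⟨hu.2, hpS u hu.1⟩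
    have hτu : τ u = z := by
      change ρ (p u) = z
      rw [← hzu, hφ.leftInverse z hz]
    rw [hτu, ← hzu]
    exact ⟨hφ.mem_domain z hz, hz, rfl⟩
  have hτd : ∀ u ∈ s₀, DifferentiableAt ℝ τ u := by
    intro u hu
    have h1 := hφ.contMDiffOn_leftInverse.contMDiffAt
      (hφ.isOpen_domain.mem_nhds (hτ u hu).1)
    have h2 := hp.contMDiffOn.contMDiffAt (hp.isOpen.mem_nhds hu.1)
    exact (h1.comp u h2).contDiffAt.differentiableAt (by simp)
  have hdens : ∀ u ∈ s₀, volumeDensity (E := E) p u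
      = ENNReal.ofReal |(fderiv ℝ τ u).det| * volumeDensity (E := E) φ (τ u) := by
    intro u hu
    refine volumeDensity_comp ?_ ?_ (hτd u hu)
    · filter_upwards [hs₀.mem_nhds hu] with z hz using (hτ z hz).2.2.symm
    · exact (hφ.contMDiffOn.contMDiffAt (hφ.isOpen.mem_nhds (hτ u hu).2.1)).mdifferentiableAt
        (by simp)
  have hpinj : Set.InjOn p Up := Set.injOn_iff_injective.2 hp.isEmbedding.injective
  have hinj : Set.InjOn τ s₀ := by
    intro u hu v hv huv
    refine hpinj hu.1 hv.1 ?_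
    rw [← (hτ u hu).2.2, ← (hτ v hv).2.2, huv]
  have hsub : Up ∩ p ⁻¹' A ⊆ s₀ := fun u hu => ⟨hu.1, hAV hu.2⟩
  have hmeas := measurableSet_inter_preimage_of_continuousOn hp.isOpen hpc hA
  rw [localVolume_apply hp.isOpen hpc hA,
    localVolume_apply hφ.isOpen hφ.contMDiffOn.continuousOn hA,
    setLIntegral_congr_fun hmeas (fun u hu => hdens u (hsub hu)),
    ← lintegral_image_eq_lintegral_abs_det_fderiv_mul volume hmeas
      (fun u hu => (hτd u (hsub hu)).hasFDerivAt.hasFDerivWithinAt) (hinj.mono hsub)]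
  refine lintegral_mono_set ?_
  rintro _ ⟨u, hu, rfl⟩
  refine ⟨(hτ u (hsub hu)).2.1, ?_⟩
  rw [Set.mem_preimage, (hτ u (hsub hu)).2.2]
  exact hu.2

theorem localVolume_compl {S : Set M} (hS : MeasurableSet S) {p : EuclideanSpace ℝ (Fin m) → M}
    {U : Set (EuclideanSpace ℝ (Fin m))} (hp : IsLocalParametrization (E := E) m S p U) :
    localVolume E p U Sᶜ = 0 := by
  have : U ∩ p ⁻¹' Sᶜ = ∅ := by
    ext u
    simp only [Set.mem_inter_iff, Set.mem_preimage, Set.mem_compl_iff, Set.mem_empty_iff_false,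
      iff_false, not_and, not_not]
    intro hu
    obtain ⟨V', -, hV'⟩ := hp.isOpen_image
    exact (hV' ▸ Set.mem_image_of_mem p hu : p u ∈ V' ∩ S).2
  rw [localVolume_apply hp.isOpen hp.contMDiffOn.continuousOn hS.compl, this]
  simp

variable [IsManifold 𝓘(ℝ, E) ∞ M]
  [IsContMDiffRiemannianBundle 𝓘(ℝ, E) ∞ E (fun x : M => TangentSpace 𝓘(ℝ, E) x)]

theorem localVolume_univ_pos {S : Set M} {φ : EuclideanSpace ℝ (Fin m) → M}
    {U : Set (EuclideanSpace ℝ (Fin m))} (h : IsLocalParametrization (E := E) m S φ U)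
    (hU : U.Nonempty) : 0 < localVolume E φ U Set.univ := by
  rw [localVolume_apply h.isOpen h.contMDiffOn.continuousOn MeasurableSet.univ,
    Set.preimage_univ, Set.inter_univ, pos_iff_ne_zero]
  intro h0
  rw [lintegral_eq_zero_iff' ((continuousOn_volumeDensity h.isOpen h.contMDiffOn).aemeasurable
    h.isOpen.measurableSet), Filter.EventuallyEq, ae_restrict_iff' h.isOpen.measurableSet] at h0
  refine (h.isOpen.measure_pos volume hU).ne' (measure_mono_null (fun u hu => ?_) (ae_iff.1 h0))
  exact fun hcon => (volumeDensity_pos (h.injective_mfderiv u hu)).ne' (hcon hu)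

/-- A parametrization of finite volume is obtained by restriction to a small neighbourhood. -/
theorem IsAdaptedParametrization.exists_finite_volume {S : Set M}
    {φ : EuclideanSpace ℝ (Fin m) → M} {U : Set (EuclideanSpace ℝ (Fin m))}
    {ρ : M → EuclideanSpace ℝ (Fin m)} {W : Set M}
    (h : IsAdaptedParametrization (E := E) m S φ U ρ W) {u : EuclideanSpace ℝ (Fin m)}
    (hu : u ∈ U) : ∃ U', u ∈ U' ∧ IsAdaptedParametrization (E := E) m S φ U' ρ W ∧
      localVolume E φ U' Set.univ < ⊤ := by
  have hc := (continuousOn_volumeDensity (E := E) h.isOpen h.contMDiffOn).continuousAt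
    (h.isOpen.mem_nhds hu)
  obtain ⟨C, hC⟩ : ∃ C : ℝ≥0∞, volumeDensity (E := E) φ u < C ∧ C < ⊤ :=
    exists_between ENNReal.ofReal_lt_top
  have hn : {z | volumeDensity (E := E) φ z < C} ∩ U ∩ Metric.ball u 1 ∈ 𝓝 u :=
    Filter.inter_mem (Filter.inter_mem (hc.eventually_lt_const hC.1) (h.isOpen.mem_nhds hu))
      (Metric.ball_mem_nhds u one_pos)
  obtain ⟨U', hU'sub, hU', huU'⟩ := mem_nhds_iff.1 hn
  have h' := h.mono hU' (fun z hz => (hU'sub hz).1.2)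
  refine ⟨U', huU', h', ?_⟩
  rw [localVolume_apply hU' h'.contMDiffOn.continuousOn MeasurableSet.univ, Set.preimage_univ,
    Set.inter_univ]
  calc ∫⁻ z in U', volumeDensity (E := E) φ z ≤ ∫⁻ z in U', C :=
        setLIntegral_mono measurable_const fun z hz => (hU'sub hz).1.1.le
    _ = C * volume U' := by simp
    _ < ⊤ := ENNReal.mul_lt_top hC.2
        ((measure_mono fun z hz => (hU'sub hz).2).trans_lt measure_ball_lt_top)

end LocalVolume

/-! ### The volume of an orbit and the Haar measure -/

section InvariantMeasure

/-- On an orbit of a compact group there is only one invariant probability measure, the image of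
the Haar measure: averaging the invariance over the group and exchanging the integrals turns
`ν A` into the Haar measure of the set of group elements that move `x` into `A`. -/
theorem eq_map_of_invariant_of_orbit {G M : Type*} [Group G] [TopologicalSpace G]
    [IsTopologicalGroup G] [MeasurableSpace G] [BorelSpace G] [TopologicalSpace M]
    [SecondCountableTopology M] [MeasurableSpace M] [BorelSpace M] [MulAction G M]
    [ContinuousSMul G M] (haar : Measure G) [IsProbabilityMeasure haar] [haar.IsMulLeftInvariant]
    {ν : Measure M} [IsProbabilityMeasure ν] (hinv : ∀ g : G, ν.map (fun y => g • y) = ν) {x : M}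
    (hν : ν (MulAction.orbit G x)ᶜ = 0) : ν = haar.map (fun g => g⁻¹ • x) := by
  have hsm : ∀ g : G, Measurable (fun y : M => g • y) := fun g =>
    (continuous_const_smul g).measurable
  have hxm : ∀ y : M, Measurable (fun g : G => g⁻¹ • y) := fun y =>
    (continuous_inv.smul continuous_const).measurable
  have hm : Measurable (fun p : G × M => p.1⁻¹ • p.2) :=
    (continuous_fst.inv.smul continuous_snd).measurable
  ext A hA
  have hind : Measurable (A.indicator (fun _ => (1 : ℝ≥0∞))) := measurable_const.indicator hA
  have h1 : ∀ g : G, ∫⁻ y, A.indicator (fun _ => (1 : ℝ≥0∞)) (g⁻¹ • y) ∂ν = ν A := by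
    intro g
    rw [← lintegral_map hind (hsm g⁻¹), hinv, lintegral_indicator_const hA, one_mul]
  have h2 : ∀ᵐ y ∂ν, ∫⁻ g, A.indicator (fun _ => (1 : ℝ≥0∞)) (g⁻¹ • y) ∂haar
      = haar.map (fun g => g⁻¹ • x) A := by
    have hae : ∀ᵐ y ∂ν, y ∈ MulAction.orbit G x := hν
    filter_upwards [hae] with y hy
    obtain ⟨h, rfl⟩ := hy
    have hc : ∀ g : G, g⁻¹ • h • x = (h⁻¹ * g)⁻¹ • x := fun g => by
      rw [mul_inv_rev, inv_inv, mul_smul]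
    simp only [hc]
    -- Left invariance of the Haar measure removes `h`.
    rw [lintegral_mul_left_eq_self (fun g : G => A.indicator (fun _ => (1 : ℝ≥0∞)) (g⁻¹ • x)),
      ← lintegral_map hind (hxm x), lintegral_indicator_const hA, one_mul]
  calc ν A = ∫⁻ _ : G, ν A ∂haar := by simp
    _ = ∫⁻ g, ∫⁻ y, A.indicator (fun _ => (1 : ℝ≥0∞)) (g⁻¹ • y) ∂ν ∂haar := by simp only [h1]
    _ = ∫⁻ y, ∫⁻ g, A.indicator (fun _ => (1 : ℝ≥0∞)) (g⁻¹ • y) ∂haar ∂ν :=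
        lintegral_lintegral_swap (hind.comp hm).aemeasurable
    _ = ∫⁻ _, haar.map (fun g => g⁻¹ • x) A ∂ν := lintegral_congr_ae h2
    _ = haar.map (fun g => g⁻¹ • x) A := by simp

end InvariantMeasure

section OrbitVolume

variable {E : Type*} [NormedAddCommGroup E] [NormedSpace ℝ E]
  {M : Type*} [TopologicalSpace M] [ChartedSpace E M]
  [RiemannianBundle (fun x : M => TangentSpace 𝓘(ℝ, E) x)] [MeasurableSpace M] [BorelSpace M]
  [SecondCountableTopology M] [T2Space M] [RegularSpace M] {m : ℕ}
  {G : Type*} [Group G] [MulAction G M]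

theorem localVolume_smul
    (hs : ∀ g : G, ContMDiff 𝓘(ℝ, E) 𝓘(ℝ, E) ∞ (fun y : M => g • y))
    (hiso : IsIsometricAction (E := E) (M := M) G) (g : G) {x : M}
    {φ : EuclideanSpace ℝ (Fin m) → M} {U : Set (EuclideanSpace ℝ (Fin m))}
    (h : IsLocalParametrization (E := E) m (MulAction.orbit G x) φ U) :
    localVolume E (fun u => g • φ u) U = (localVolume E φ U).map (fun y => g • y) := by
  have h' := h.smul hs g
  have hgm : Measurable (fun y : M => g • y) := (hs g).continuous.measurable
  ext A hA
  rw [Measure.map_apply hgm hA, localVolume_apply h'.isOpen h'.contMDiffOn.continuousOn hA,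
    localVolume_apply h.isOpen h.contMDiffOn.continuousOn (hgm hA)]
  refine setLIntegral_congr_fun (measurableSet_inter_preimage_of_continuousOn h.isOpen
    h'.contMDiffOn.continuousOn hA) fun u hu => ?_
  exact volumeDensity_smul hs hiso g
    ((h.contMDiffOn.contMDiffAt (h.isOpen.mem_nhds hu.1)).mdifferentiableAt (by simp))

theorem submanifoldVolume_orbit_map_smul
    (hs : ∀ g : G, ContMDiff 𝓘(ℝ, E) 𝓘(ℝ, E) ∞ (fun y : M => g • y))
    (hiso : IsIsometricAction (E := E) (M := M) G) (g : G) (x : M) :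
    (submanifoldVolume (E := E) m (MulAction.orbit G x)).map (fun y => g • y)
      = submanifoldVolume (E := E) m (MulAction.orbit G x) := by
  have hgm : ∀ g : G, Measurable (fun y : M => g • y) := fun g => (hs g).continuous.measurable
  have hle : ∀ g : G, submanifoldVolume (E := E) m (MulAction.orbit G x)
      ≤ (submanifoldVolume (E := E) m (MulAction.orbit G x)).map (fun y => g • y) := by
    intro g
    refine submanifoldVolume_le fun φ U h => ?_
    have h1 := localVolume_smul hs hiso g (h.smul hs g⁻¹)
    simp only [smul_inv_smul] at h1
    rw [h1]
    exact Measure.map_mono (localVolume_le_submanifoldVolume (h.smul hs g⁻¹)) (hgm g)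
  refine le_antisymm ?_ (hle g)
  have h := Measure.map_mono (hle g⁻¹) (hgm g)
  rw [Measure.map_map (hgm g) (hgm g⁻¹)] at h
  have hid : (fun y : M => g • y) ∘ (fun y : M => g⁻¹ • y) = id := by
    ext y
    simp
  rwa [hid, Measure.map_id] at h

variable [IsManifold 𝓘(ℝ, E) ∞ M]
  [IsContMDiffRiemannianBundle 𝓘(ℝ, E) ∞ E (fun x : M => TangentSpace 𝓘(ℝ, E) x)]

/-- If an orbit is compact and embedded near one of its points, then its volume is finite and
carried by it: it is covered by finitely many translates of one parametrization. -/
theorem submanifoldVolume_orbit_lt_top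
    (hs : ∀ g : G, ContMDiff 𝓘(ℝ, E) 𝓘(ℝ, E) ∞ (fun y : M => g • y))
    (hiso : IsIsometricAction (E := E) (M := M) G) {x : M}
    (hcomp : IsCompact (MulAction.orbit G x))
    {φ : EuclideanSpace ℝ (Fin m) → M} {U : Set (EuclideanSpace ℝ (Fin m))}
    {ρ : M → EuclideanSpace ℝ (Fin m)} {W : Set M}
    (h : IsAdaptedParametrization (E := E) m (MulAction.orbit G x) φ U ρ W) (hx : x ∈ φ '' U) :
    submanifoldVolume (E := E) m (MulAction.orbit G x) Set.univ < ⊤ ∧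
      submanifoldVolume (E := E) m (MulAction.orbit G x) (MulAction.orbit G x)ᶜ = 0 := by
  have hgm : ∀ g : G, Measurable (fun y : M => g • y) := fun g => (hs g).continuous.measurable
  have hSm : MeasurableSet (MulAction.orbit G x) := hcomp.measurableSet
  obtain ⟨u, hu, hux⟩ := hx
  obtain ⟨U', hu', h', hfin⟩ := h.exists_finite_volume hu
  choose V hV hVS using fun g : G => (h'.smul hs g).isOpen_image
  have hcover : MulAction.orbit G x ⊆ ⋃ g : G, V g := by
    rintro _ ⟨g, rfl⟩
    have : g • x ∈ V g ∩ MulAction.orbit G x := hVS g ▸ ⟨u, hu', by simp [hux]⟩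
    exact Set.mem_iUnion.2 ⟨g, this.1⟩
  obtain ⟨t, ht⟩ := hcomp.elim_finite_subcover V hV hcover
  have hbound : submanifoldVolume (E := E) m (MulAction.orbit G x)
      ≤ ∑ g ∈ t, localVolume E (fun u => g • φ u) U' := by
    refine submanifoldVolume_le fun p Up hp => Measure.le_iff.2 fun A hA => ?_
    have hsub : A ⊆ (MulAction.orbit G x)ᶜ ∪ ⋃ g ∈ t, (A ∩ V g) := by
      intro y hy
      by_cases hyS : y ∈ MulAction.orbit G x
      · obtain ⟨g, hg, hyg⟩ := Set.mem_iUnion₂.1 (ht hyS)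
        exact Or.inr (Set.mem_iUnion₂.2 ⟨g, hg, hy, hyg⟩)
      · exact Or.inl hyS
    calc localVolume E p Up A
        ≤ localVolume E p Up (MulAction.orbit G x)ᶜ
          + localVolume E p Up (⋃ g ∈ t, (A ∩ V g)) :=
          (measure_mono hsub).trans (measure_union_le _ _)
      _ ≤ 0 + ∑ g ∈ t, localVolume E p Up (A ∩ V g) :=
          add_le_add (localVolume_compl hSm hp).le (measure_biUnion_finset_le _ _)
      _ ≤ ∑ g ∈ t, localVolume E (fun u => g • φ u) U' A := by
          rw [zero_add]
          refine Finset.sum_le_sum fun g _ => ?_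
          exact (localVolume_le_of_subset hp (h'.smul hs g) (hV g) (hVS g)
            (hA.inter (hV g).measurableSet) Set.inter_subset_right).trans
              (measure_mono Set.inter_subset_left)
      _ = (∑ g ∈ t, localVolume E (fun u => g • φ u) U') A := by
          rw [Measure.finsetSum_apply]
  constructor
  · refine (hbound Set.univ).trans_lt ?_
    rw [Measure.finsetSum_apply]
    refine ENNReal.sum_lt_top.2 fun g _ => ?_
    rw [localVolume_smul hs hiso g h'.toIsLocalParametrization,
      Measure.map_apply (hgm g) MeasurableSet.univ, Set.preimage_univ]
    exact hfin
  · refine le_antisymm ((hbound _).trans ?_) bot_le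
    rw [Measure.finsetSum_apply]
    exact (Finset.sum_eq_zero fun g _ =>
      localVolume_compl hSm (h'.smul hs g).toIsLocalParametrization).le

end OrbitVolume

section OrbitVol

variable {E : Type*} [NormedAddCommGroup E] [NormedSpace ℝ E] [FiniteDimensional ℝ E]
  {M : Type*} [TopologicalSpace M] [ChartedSpace E M] [IsManifold 𝓘(ℝ, E) ∞ M]
  [RiemannianBundle (fun x : M => TangentSpace 𝓘(ℝ, E) x)]
  [IsContMDiffRiemannianBundle 𝓘(ℝ, E) ∞ E (fun x : M => TangentSpace 𝓘(ℝ, E) x)]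
  [MeasurableSpace M] [BorelSpace M] [SecondCountableTopology M] [T2Space M] [RegularSpace M]
  {L : Type*} [NormedAddCommGroup L] [NormedSpace ℝ L] [FiniteDimensional ℝ L]
  {G : Type*} [Group G] [TopologicalSpace G] [CompactSpace G] [ChartedSpace L G]
  [LieGroup 𝓘(ℝ, L) ∞ G] [MulAction G M] [ContMDiffSMul 𝓘(ℝ, L) 𝓘(ℝ, E) ∞ G M]

theorem isProbabilityMeasure_orbitVol_and_compl
    (hiso : IsIsometricAction (E := E) (M := M) G) (x : M) :
    IsProbabilityMeasure (orbitVol (E := E) (L := L) G x) ∧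
      orbitVol (E := E) (L := L) G x (MulAction.orbit G x)ᶜ = 0 := by
  have hs : ∀ g : G, ContMDiff 𝓘(ℝ, E) 𝓘(ℝ, E) ∞ (fun y : M => g • y) :=
    fun g => ContMDiffSMul.contMDiff_const_smul (I := 𝓘(ℝ, L)) g
  obtain ⟨φ, U, ρ, W, h, hx⟩ := exists_isAdaptedParametrization_orbit (E := E) (L := L) (G := G) x
  have hcomp : IsCompact (MulAction.orbit G x) :=
    isCompact_range (contMDiff_orbitMap (E := E) (L := L) x).continuous
  obtain ⟨hfin, hcompl⟩ := submanifoldVolume_orbit_lt_top hs hiso hcomp h hx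
  have hpos := (localVolume_univ_pos h.toIsLocalParametrization
    (Set.image_nonempty.1 ⟨x, hx⟩)).trans_le
      (localVolume_le_submanifoldVolume h.toIsLocalParametrization Set.univ)
  constructor
  · refine ⟨?_⟩
    simp only [orbitVol, Measure.smul_apply, smul_eq_mul]
    exact ENNReal.inv_mul_cancel hpos.ne' hfin.ne
  · simp only [orbitVol, Measure.smul_apply, smul_eq_mul]
    rw [hcompl, mul_zero]

theorem orbitVol_eq_map_haar [MeasurableSpace G] [BorelSpace G]
    (hiso : IsIsometricAction (E := E) (M := M) G) (haar : Measure G) [IsProbabilityMeasure haar]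
    [haar.IsMulLeftInvariant] (x : M) :
    orbitVol (E := E) (L := L) G x = haar.map (fun g => g⁻¹ • x) := by
  have hs : ∀ g : G, ContMDiff 𝓘(ℝ, E) 𝓘(ℝ, E) ∞ (fun y : M => g • y) :=
    fun g => ContMDiffSMul.contMDiff_const_smul (I := 𝓘(ℝ, L)) g
  have : ContinuousSMul G M := ContMDiffSMul.continuousSMul (I := 𝓘(ℝ, L)) (I' := 𝓘(ℝ, E)) ∞
  have : IsTopologicalGroup G := topologicalGroup_of_lieGroup 𝓘(ℝ, L) ∞
  obtain ⟨hprob, hcompl⟩ := isProbabilityMeasure_orbitVol_and_compl (L := L) hiso x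
  refine eq_map_of_invariant_of_orbit haar (fun g => ?_) hcompl
  simp only [orbitVol]
  rw [Measure.map_smul, submanifoldVolume_orbit_map_smul hs hiso]

end OrbitVol

/-! ### Equivariant maps on orbits -/

section Equivariant

/-- An equivariant map is continuous on the orbits of a compact group, whose orbit maps are closed
and hence quotient maps onto the orbits. -/
theorem continuousOn_orbit_of_equivariant {G X Y : Type*} [Group G] [TopologicalSpace G]
    [CompactSpace G] [TopologicalSpace X] [T2Space X] [MulAction G X] [TopologicalSpace Y]
    [MulAction G Y] {T : X → Y} {x : X} (hx : Continuous (fun g : G => g • x))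
    (hTx : Continuous (fun g : G => g • T x)) (hT : ∀ g : G, T (g • x) = g • T x) :
    ContinuousOn T (MulAction.orbit G x) := by
  refine continuousOn_iff_isClosed.2 fun C hC => ?_
  refine ⟨(fun g : G => g • x) '' ((fun g : G => g • T x) ⁻¹' C),
    hx.isClosedMap _ (hC.preimage hTx), ?_⟩
  ext y
  constructor
  · rintro ⟨hy, g, rfl⟩
    refine ⟨⟨g, ?_, rfl⟩, g, rfl⟩
    rw [Set.mem_preimage, ← hT]
    exact hy
  · rintro ⟨⟨g, hg, rfl⟩, hy⟩
    refine ⟨?_, hy⟩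
    rw [Set.mem_preimage, hT]
    exact hg

end Equivariant

end OrbitTransport

end

theorem mainTheorem6
    -- the complete Riemannian manifold `M`
    {E : Type*} [NormedAddCommGroup E] [NormedSpace ℝ E] [FiniteDimensional ℝ E]
    {M : Type*} [EMetricSpace M] [SecondCountableTopology M] [ChartedSpace E M]
    [IsManifold 𝓘(ℝ, E) ∞ M]
    [RiemannianBundle (fun x : M => TangentSpace 𝓘(ℝ, E) x)]
    [IsContMDiffRiemannianBundle 𝓘(ℝ, E) ∞ E (fun x : M => TangentSpace 𝓘(ℝ, E) x)]
    [IsRiemannianManifold 𝓘(ℝ, E) M] [CompleteSpace M]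
    [MeasurableSpace M] [BorelSpace M]
    -- the compact Lie group `G` and its smooth isometric action
    {L : Type*} [NormedAddCommGroup L] [NormedSpace ℝ L] [FiniteDimensional ℝ L]
    {G : Type*} [Group G] [TopologicalSpace G] [T2Space G] [CompactSpace G] [ChartedSpace L G]
    [LieGroup 𝓘(ℝ, L) ∞ G]
    [MulAction G M] [ContMDiffSMul 𝓘(ℝ, L) 𝓘(ℝ, E) ∞ G M]
    (hiso : OrbitTransport.IsIsometricAction (E := E) (M := M) G)
    -- the slice, as the range of an embedding `ι : S → M`
    {F : Type*} [NormedAddCommGroup F] [NormedSpace ℝ F] [FiniteDimensional ℝ F]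
    {S : Type*} [TopologicalSpace S] [ChartedSpace F S] [IsManifold 𝓘(ℝ, F) ∞ S]
    (ι : S → M) (s₀ : S)
    (hslice : OrbitTransport.IsSlice (E := E) (L := L) G (F := F) ι s₀)
    -- the invariant function on the tube
    (ψ : M → ℝ)
    (hψ : ContMDiffOn 𝓘(ℝ, E) 𝓘(ℝ, ℝ) 1 ψ (OrbitTransport.tube G (Set.range ι)))
    (hinv : ∀ g : G, ∀ x ∈ OrbitTransport.tube G (Set.range ι), ψ (g • x) = ψ x)
    -- the map `T(x) = exp_x(∇ψ(x))` on the tube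
    (T : M → M)
    (hT : ∀ x ∈ OrbitTransport.tube G (Set.range ι),
      T x = OrbitTransport.riemannianExp x (OrbitTransport.riemannianGradient (E := E) ψ x)) :
    (∀ g : G, ∀ x ∈ OrbitTransport.tube G (Set.range ι), T (g • x) = g • T x) ∧
    (∀ x ∈ OrbitTransport.tube G (Set.range ι),
      T '' MulAction.orbit G x = MulAction.orbit G (T x)) ∧
    (∀ x ∈ OrbitTransport.tube G (Set.range ι),
      IsProbabilityMeasure (OrbitTransport.orbitVol (E := E) (L := L) G x) ∧
      IsProbabilityMeasure (OrbitTransport.orbitVol (E := E) (L := L) G (T x)) ∧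
      OrbitTransport.IsTransportMap T (OrbitTransport.orbitVol (E := E) (L := L) G x)
        (OrbitTransport.orbitVol (E := E) (L := L) G (T x))) := by
  have hs : ∀ g : G, ContMDiff 𝓘(ℝ, E) 𝓘(ℝ, E) ∞ (fun y : M => g • y) :=
    fun g => ContMDiffSMul.contMDiff_const_smul (I := 𝓘(ℝ, L)) g
  have hopen := hslice.isOpen_tube
  have hequiv : ∀ g : G, ∀ x ∈ OrbitTransport.tube G (Set.range ι), T (g • x) = g • T x := by
    intro g x hx
    have hgx := OrbitTransport.smul_mem_tube g hx
    have hgrad := OrbitTransport.riemannianGradient_smul hs hiso g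
      ((hψ.contMDiffAt (hopen.mem_nhds hgx)).mdifferentiableAt one_ne_zero)
      (Filter.mem_of_superset (hopen.mem_nhds hx) fun y hy => hinv g y hy)
    rw [hT _ hgx, hT _ hx, hgrad, OrbitTransport.riemannianExp_smul hs hiso]
  refine ⟨hequiv, ?_, ?_⟩
  · intro x hx
    ext y
    constructor
    · rintro ⟨_, ⟨g, rfl⟩, rfl⟩
      exact ⟨g, (hequiv g x hx).symm⟩
    · rintro ⟨g, rfl⟩
      exact ⟨g • x, ⟨g, rfl⟩, hequiv g x hx⟩
  · intro x hx
    obtain ⟨hprob, hcompl⟩ :=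
      OrbitTransport.isProbabilityMeasure_orbitVol_and_compl (L := L) hiso x
    refine ⟨hprob, (OrbitTransport.isProbabilityMeasure_orbitVol_and_compl (L := L) hiso
      (T x)).1, ?_⟩
    have hfx := (OrbitTransport.contMDiff_orbitMap (E := E) (L := L) (G := G) x).continuous
    have hTx := (OrbitTransport.contMDiff_orbitMap (E := E) (L := L) (G := G) (T x)).continuous
    have haem : AEMeasurable T (OrbitTransport.orbitVol (E := E) (L := L) G x) := by
      have hc := OrbitTransport.continuousOn_orbit_of_equivariant hfx hTx
        (fun g => hequiv g x hx)
      have h := hc.aemeasurable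
        (μ := OrbitTransport.orbitVol (E := E) (L := L) G x)
        (isCompact_range hfx).measurableSet
      have hae : ∀ᵐ y ∂OrbitTransport.orbitVol (E := E) (L := L) G x,
          y ∈ MulAction.orbit G x := hcompl
      rwa [Measure.restrict_eq_self_of_ae_mem hae] at h
    refine ⟨haem, ?_⟩
    let _ : MeasurableSpace G := borel G
    have : BorelSpace G := ⟨rfl⟩
    have : IsTopologicalGroup G := topologicalGroup_of_lieGroup 𝓘(ℝ, L) ∞
    -- Haar measure normalized to total mass one, as `⊤` is the whole compact group.
    let haar : Measure G := Measure.haarMeasure ⊤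
    have : IsProbabilityMeasure haar := ⟨Measure.haarMeasure_self (K₀ := ⊤)⟩
    have hx' := OrbitTransport.orbitVol_eq_map_haar (L := L) hiso haar x
    rw [hx'] at haem
    rw [hx', OrbitTransport.orbitVol_eq_map_haar (L := L) hiso haar (T x),
      AEMeasurable.map_map_of_aemeasurable haem (hfx.comp continuous_inv).measurable.aemeasurable]
    -- `T` turns the orbit map of `x` into that of `T x`.
    congr 1
    ext g
    exact hequiv g⁻¹ x hx
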